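/- All spaces are real. For $1\le r<\infty$, $L_r[0,1]$ is taken with respect to Lebesgue measure, and "subspace" means linear subspace (not necessarily closed). A subspace $E\subseteq L_p[0,1]$ is said to do stable phase retrieval (SPR) if there is a constant $C>0$ such that $$\inf_{|\lambda|=1}\|f-\lambda g\|_{L_p}\le C\,\big\||f|-|g|\big\|_{L_p}\qquad\text{for all } f,g\in E,$$ where $\lambda$ runs over the real scalars of modulus one. Two normed spaces $E,F$ are called $C$-isomorphic if there is a linear homeomorphism $T$ from $E$ onto $F$ with $\|T\|\,\|T^{-1}\|\le C$. Suppose $p,q\in[1,\infty)$, and either (1) $1\le p<q\le 2$, or (2) $q=2<p<\infty$. Then: (a) There exists $\varepsilon>0$, depending only on $p$ and $q$, such that if a subspace $E\subseteq L_p[0,1]$ is $(1+\varepsilon)$-isomorphic to a subspace $F\subseteq L_q[0,1]$, then $E$ does SPR in $L_p[0,1]$. (b) $L_p[0,1]$ contains a subspace which is linearly isometric to $L_q[0,1]$ and does SPR in $L_p[0,1]$. -/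

import Mathlib

open MeasureTheory
open scoped ENNReal

/-- The real Lebesgue space `L_p[0,1]`, with Lebesgue measure on `[0,1]`. -/
abbrev LpUnit (p : ℝ≥0∞) : Type := Lp ℝ p (volume : Measure unitInterval)

/-- A linear subspace `E` of a real normed lattice `X` does `C`-stable phase retrieval if
`inf_{|l| = 1} ‖f - l g‖ ≤ C ‖|f| - |g|‖` for all `f, g ∈ E`; here `l` runs over the real scalars
of modulus one, and `|f| = f ⊔ (-f)` is the lattice modulus. -/
def DoesStablePhaseRetrievalWith {X : Type*} [NormedAddCommGroup X] [Lattice X] [HasSolidNorm X]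
    [IsOrderedAddMonoid X] [NormedSpace ℝ X] (C : ℝ) (E : Submodule ℝ X) : Prop :=
  ∀ f ∈ E, ∀ g ∈ E, ⨅ l : Metric.sphere (0 : ℝ) 1, ‖f - (l : ℝ) • g‖ ≤ C * ‖|f| - |g|‖

/-- A linear subspace `E` of a real normed lattice does stable phase retrieval (SPR) if it does
`C`-stable phase retrieval for some constant `C`. -/
def DoesSPR {X : Type*} [NormedAddCommGroup X] [Lattice X] [HasSolidNorm X]
    [IsOrderedAddMonoid X] [NormedSpace ℝ X] (E : Submodule ℝ X) : Prop :=
  ∃ C : ℝ, 0 < C ∧ DoesStablePhaseRetrievalWith C E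

/-- Two normed spaces are `C`-isomorphic if there is a linear homeomorphism `T` of one onto the
other with `‖T‖ ‖T⁻¹‖ ≤ C`. -/
def IsIsomorphicWith (C : ℝ) (E F : Type*) [NormedAddCommGroup E] [NormedSpace ℝ E]
    [NormedAddCommGroup F] [NormedSpace ℝ F] : Prop :=
  ∃ T : E ≃L[ℝ] F, ‖(T : E →L[ℝ] F)‖ * ‖(T.symm : F →L[ℝ] E)‖ ≤ C

/-! ### Powers of `L_p` norms and the type inequality. -/

section Norms

variable {α : Type*} [MeasurableSpace α] {μ : Measure α} {p : ℝ≥0∞}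

/-! For real functions `||f| - |g|| = |f + g| ⊓ |f - g|`, so stable phase retrieval holds as soon as
no two normalized `u, v` in `E` are almost disjoint, that is, as soon as `‖|u| ⊓ |v|‖` is bounded
below (`doesSPR_of_forall_le_norm_inf`).

Almost disjoint normalized vectors of `L_p` satisfy `‖u ± v‖ ≈ 2 ^ (1 / p)` for both signs
(`norm_add_bounds_of_norm_eq_one`). A near-isometric copy inside `L_q` forbids this. If `p < q ≤ 2`,
the type `q` inequality forces one of the two norms to be at most about `2 ^ (1 / q) < 2 ^ (1 / p)`;
if `q = 2 < p`, the parallelogram law forces one to be at least about `√2 > 2 ^ (1 / p)`. This gap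
gives (a).

Part (b) follows from (a) once `L_q[0,1]` embeds isometrically in `L_p[0,1]`. By Gaussian
randomization it suffices to realize a multiple of the norm as `(∫ (∑ |F i v|²) ^ (p / 2)) ^ (1 /
p)` with linear coordinates `F i` (`exists_linearIsometry_LpUnit`). For `q = 2` the coordinates in a
Hilbert basis do. For `p < q < 2` the points `(s, u)` of a Poisson process on `(0, ∞) × [0, 1]`
contribute `s ^ (-1 / q) f(u)`. The sum of their squares is a positive `q / 2`-stable variable with
Laplace exponent proportional to `t ^ (q / 2) ‖f‖ ^ q`, so its moment of order `p / 2 < q / 2` is a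
multiple of `‖f‖ ^ p`. -/

theorem Lp_enorm_rpow {E : Type*} [NormedAddCommGroup E] (hp0 : p ≠ 0) (hp : p ≠ ∞)
    (f : Lp E p μ) :
    ‖f‖ₑ ^ p.toReal = ∫⁻ x, ‖f x‖ₑ ^ p.toReal ∂μ := by
  have hpos : 0 < p.toReal := ENNReal.toReal_pos hp0 hp
  rw [Lp.enorm_def, eLpNorm_eq_lintegral_rpow_enorm_toReal hp0 hp, ← ENNReal.rpow_mul,
    one_div_mul_cancel hpos.ne', ENNReal.rpow_one]

theorem enorm_rpow_eq_ofReal {E : Type*} [NormedAddCommGroup E] (x : E) {r : ℝ} (hr : 0 ≤ r) :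
    ‖x‖ₑ ^ r = ENNReal.ofReal (‖x‖ ^ r) := by
  rw [← ofReal_norm, ENNReal.ofReal_rpow_of_nonneg (norm_nonneg _) hr]

/-- The function `t ^ (q / 2)` is concave and subadditive. Concavity is applied to `(a + b)²` and
`(a - b)²`, whose mean is `a² + b²`, and subadditivity then separates `a²` from `b²`. -/
theorem abs_add_rpow_add_abs_sub_rpow_le {q : ℝ} (hq : 0 < q) (hq2 : q ≤ 2) (a b : ℝ) :
    |a + b| ^ q + |a - b| ^ q ≤ 2 * (|a| ^ q + |b| ^ q) := by
  have key : ∀ x : ℝ, |x| ^ q = (x ^ 2) ^ (q / 2) := fun x => by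
    rw [← sq_abs, ← Real.rpow_natCast, ← Real.rpow_mul (abs_nonneg _)]; congr 1; push_cast; ring
  have hc := (Real.concaveOn_rpow (p := q / 2) (by linarith) (by linarith)).2
    (show (a + b) ^ 2 ∈ Set.Ici (0 : ℝ) from sq_nonneg (a + b))
    (show (a - b) ^ 2 ∈ Set.Ici (0 : ℝ) from sq_nonneg (a - b))
    (show (0 : ℝ) ≤ 1 / 2 by norm_num) (show (0 : ℝ) ≤ 1 / 2 by norm_num) (by norm_num)
  simp only [smul_eq_mul] at hc
  have h2 : (1 / 2 * (a + b) ^ 2 + 1 / 2 * (a - b) ^ 2 : ℝ) = a ^ 2 + b ^ 2 := by ring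
  rw [h2] at hc
  have h3 := Real.rpow_add_le_add_rpow (sq_nonneg a) (sq_nonneg b)
    (show 0 ≤ q / 2 by linarith) (by linarith)
  rw [key, key, key, key]
  linarith

theorem norm_rpow_add_norm_rpow_eq_of_ae_eq [Fact (1 ≤ p)] {u v w : Lp ℝ p μ} (hp0 : p ≠ 0)
    (hp : p ≠ ∞)
    (h : ∀ᵐ x ∂μ, |w x| ^ p.toReal = |u x| ^ p.toReal + |v x| ^ p.toReal) :
    ‖w‖ ^ p.toReal = ‖u‖ ^ p.toReal + ‖v‖ ^ p.toReal := by
  have hpos : 0 ≤ p.toReal := ENNReal.toReal_nonneg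
  rw [← ENNReal.ofReal_eq_ofReal_iff (by positivity) (by positivity),
    ENNReal.ofReal_add (by positivity) (by positivity)]
  simp only [← enorm_rpow_eq_ofReal _ hpos, Lp_enorm_rpow hp0 hp]
  rw [← lintegral_add_left' ((Lp.aestronglyMeasurable u).enorm.pow_const _)]
  refine lintegral_congr_ae ?_
  filter_upwards [h] with x hx
  simp only [enorm_rpow_eq_ofReal _ hpos, Real.norm_eq_abs]
  rw [hx, ENNReal.ofReal_add (by positivity) (by positivity)]

/-- The type `q` inequality of `L_q`, for `q ≤ 2`. -/
theorem norm_add_rpow_add_norm_sub_rpow_le {q : ℝ≥0∞} [Fact (1 ≤ q)] (hq0 : q ≠ 0)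
    (hq : q ≤ 2) (x y : Lp ℝ q μ) :
    ‖x + y‖ ^ q.toReal + ‖x - y‖ ^ q.toReal ≤ 2 * (‖x‖ ^ q.toReal + ‖y‖ ^ q.toReal) := by
  have hqt : q ≠ ∞ := (hq.trans_lt (by simp)).ne
  have hpos : 0 < q.toReal := ENNReal.toReal_pos hq0 hqt
  have hq2 : q.toReal ≤ 2 := by
    simpa using ENNReal.toReal_mono (by simp) hq
  rw [← ENNReal.ofReal_le_ofReal_iff (by positivity), ENNReal.ofReal_mul (by norm_num),
    ENNReal.ofReal_add (by positivity) (by positivity),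
    ENNReal.ofReal_add (by positivity) (by positivity)]
  simp only [← enorm_rpow_eq_ofReal _ hpos.le, Lp_enorm_rpow hq0 hqt]
  rw [← lintegral_add_left' ((Lp.aestronglyMeasurable _).enorm.pow_const _),
    ← lintegral_add_left' ((Lp.aestronglyMeasurable _).enorm.pow_const _),
    ← lintegral_const_mul' _ _ (by simp)]
  refine lintegral_mono_ae ?_
  filter_upwards [Lp.coeFn_add x y, Lp.coeFn_sub x y] with t h1 h2
  rw [h1, h2]
  simp only [enorm_rpow_eq_ofReal _ hpos.le, Real.norm_eq_abs, Pi.add_apply, Pi.sub_apply]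
  rw [← ENNReal.ofReal_add (by positivity) (by positivity),
    ← ENNReal.ofReal_add (by positivity) (by positivity), ← ENNReal.ofReal_mul (by norm_num)]
  exact ENNReal.ofReal_le_ofReal (abs_add_rpow_add_abs_sub_rpow_le hpos hq2 _ _)

end Norms

/-! ### Stable phase retrieval and almost disjoint pairs. -/

section AlmostDisjoint

theorem abs_abs_sub_abs_eq_min (a b : ℝ) : |(|a| - |b|)| = min |a + b| |a - b| := by
  rw [min_def]
  split_ifs <;> grind

variable {α : Type*} [MeasurableSpace α] {μ : Measure α} {p : ℝ≥0∞}

theorem abs_abs_sub_abs_eq_inf (f g : Lp ℝ p μ) : |(|f| - |g|)| = |f + g| ⊓ |f - g| := by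
  refine Lp.ext ?_
  filter_upwards [Lp.coeFn_abs f, Lp.coeFn_abs g, Lp.coeFn_abs (|f| - |g|), Lp.coeFn_sub |f| |g|,
    Lp.coeFn_inf |f + g| |f - g|, Lp.coeFn_abs (f + g), Lp.coeFn_abs (f - g), Lp.coeFn_add f g,
    Lp.coeFn_sub f g] with x h1 h2 h3 h4 h5 h6 h7 h8 h9
  rw [h3, h4, h5, Pi.sub_apply, Pi.inf_apply, h6, h7, h8, h9, h1, h2, Pi.add_apply, Pi.sub_apply]
  change |(|f x| - |g x|)| = min _ _
  exact abs_abs_sub_abs_eq_min _ _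

variable [Fact (1 ≤ p)]

theorem norm_abs_sub_abs_le_norm_add (u v : Lp ℝ p μ) : ‖|u| - |v|‖ ≤ ‖u + v‖ := by
  refine norm_le_norm_of_abs_le_abs ?_
  have := abs_abs_sub_abs_le u (-v)
  simpa using this

/-- Pointwise, `|a| + |b|` equals `||a| - |b|| + 2 min(|a|, |b|)`. -/
theorem norm_add_le_norm_abs_sub_abs (u v : Lp ℝ p μ) :
    ‖u + v‖ ≤ ‖|u| - |v|‖ + 2 * ‖|u| ⊓ |v|‖ := by
  have h : ‖u + v‖ ≤ ‖|(|u| - |v|)| + (2 : ℝ) • (|u| ⊓ |v|)‖ := by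
    refine Lp.norm_le_norm_of_ae_le ?_
    filter_upwards [Lp.coeFn_abs u, Lp.coeFn_abs v, Lp.coeFn_abs (|u| - |v|),
      Lp.coeFn_sub |u| |v|, Lp.coeFn_inf |u| |v|, Lp.coeFn_add u v,
      Lp.coeFn_smul (2 : ℝ) (|u| ⊓ |v|), Lp.coeFn_add |(|u| - |v|)| ((2 : ℝ) • (|u| ⊓ |v|))]
      with x h1 h2 h3 h4 h5 h6 h7 h8
    rw [h8, h6, Pi.add_apply, Pi.add_apply, h3, h4, h7, Pi.smul_apply, h5, Pi.sub_apply,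
      Pi.inf_apply, h1, h2]
    change |u x + v x| ≤ |(|(|u x| - |v x|)| + 2 * min |u x| |v x|)|
    refine le_trans (abs_add_le _ _) (le_trans (le_of_eq ?_) (le_abs_self _))
    rcases le_total |u x| |v x| with h | h
    · rw [min_eq_left h, abs_of_nonpos (sub_nonpos.2 h)]; ring
    · rw [min_eq_right h, abs_of_nonneg (sub_nonneg.2 h)]; ring
  refine h.trans ((norm_add_le _ _).trans (le_of_eq ?_))
  rw [norm_abs_eq_norm, norm_smul]
  norm_num

/-- At each point one of `|u|`, `|v|` equals the minimum, so the two remainders are disjointly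
supported and their norms add in `p`-th powers. -/
theorem norm_abs_sub_abs_rpow (hp : p ≠ ∞) (u v : Lp ℝ p μ) :
    ‖|u| - |v|‖ ^ p.toReal =
      ‖|u| - |u| ⊓ |v|‖ ^ p.toReal + ‖|v| - |u| ⊓ |v|‖ ^ p.toReal := by
  have hp0 : p ≠ 0 := (zero_lt_one.trans_le Fact.out).ne'
  refine norm_rpow_add_norm_rpow_eq_of_ae_eq hp0 hp ?_
  filter_upwards [Lp.coeFn_abs u, Lp.coeFn_abs v, Lp.coeFn_sub |u| |v|, Lp.coeFn_inf |u| |v|,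
    Lp.coeFn_sub |u| (|u| ⊓ |v|), Lp.coeFn_sub |v| (|u| ⊓ |v|)] with x h1 h2 h3 h4 h5 h6
  rw [h3, h5, h6]
  simp only [Pi.sub_apply, h4, Pi.inf_apply, h1, h2]
  have hr : p.toReal ≠ 0 := (ENNReal.toReal_pos hp0 hp).ne'
  rcases le_total |u x| |v x| with h | h
  · rw [inf_eq_left.2 h, sub_self, abs_zero, Real.zero_rpow hr, zero_add, abs_sub_comm]
  · rw [inf_eq_right.2 h, sub_self, abs_zero, Real.zero_rpow hr, add_zero]

theorem norm_abs_sub_inf_le (u w : Lp ℝ p μ) (hw : 0 ≤ w) (hwu : w ≤ |u|) : ‖|u| - w‖ ≤ ‖u‖ := by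
  refine norm_le_norm_of_abs_le_abs ?_
  rw [abs_of_nonneg (sub_nonneg.2 hwu)]
  exact sub_le_self _ hw

/-- Removing `|u| ⊓ |v|` makes the moduli disjoint, and each remainder has norm between `1 - ‖|u| ⊓
|v|‖` and `1`. Passing from `||u| - |v||` to `u + v` costs at most `2 ‖|u| ⊓ |v|‖` above and nothing
below. -/
theorem norm_add_bounds_of_norm_eq_one (hp : p ≠ ∞) {u v : Lp ℝ p μ} (hu : ‖u‖ = 1)
    (hv : ‖v‖ = 1) :
    (2 : ℝ) ^ (1 / p.toReal) * (1 - ‖|u| ⊓ |v|‖) ≤ ‖u + v‖ ∧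
      ‖u + v‖ ≤ (2 : ℝ) ^ (1 / p.toReal) + 2 * ‖|u| ⊓ |v|‖ := by
  have hp0 : p ≠ 0 := (zero_lt_one.trans_le Fact.out).ne'
  have hr : 0 < p.toReal := ENNReal.toReal_pos hp0 hp
  have hw : 0 ≤ |u| ⊓ |v| := le_inf (abs_nonneg u) (abs_nonneg v)
  have h1 := norm_abs_sub_inf_le u _ hw inf_le_left
  have h2 := norm_abs_sub_inf_le v _ hw inf_le_right
  have h3 : 1 - ‖|u| ⊓ |v|‖ ≤ ‖|u| - |u| ⊓ |v|‖ := by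
    have := norm_sub_norm_le |u| (|u| ⊓ |v|)
    rwa [norm_abs_eq_norm, hu] at this
  have h4 : 1 - ‖|u| ⊓ |v|‖ ≤ ‖|v| - |u| ⊓ |v|‖ := by
    have := norm_sub_norm_le |v| (|u| ⊓ |v|)
    rwa [norm_abs_eq_norm, hv] at this
  rw [hu] at h1
  rw [hv] at h2
  have hN := norm_abs_sub_abs_rpow hp u v
  have hN' : ‖|u| - |v|‖ = (‖|u| - |v|‖ ^ p.toReal) ^ (1 / p.toReal) := by
    rw [← Real.rpow_mul (norm_nonneg _), mul_one_div_cancel hr.ne', Real.rpow_one]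
  constructor
  · refine le_trans ?_ (norm_abs_sub_abs_le_norm_add u v)
    -- The lower bound is trivial when the overlap has norm at least one.
    rcases le_total (1 - ‖|u| ⊓ |v|‖) 0 with hd | hd
    · exact (mul_nonpos_of_nonneg_of_nonpos (by positivity) hd).trans (norm_nonneg _)
    · have : (2 : ℝ) ^ (1 / p.toReal) * (1 - ‖|u| ⊓ |v|‖)
          = (2 * (1 - ‖|u| ⊓ |v|‖) ^ p.toReal) ^ (1 / p.toReal) := by
        rw [Real.mul_rpow (by norm_num) (by positivity), ← Real.rpow_mul hd,
          mul_one_div_cancel hr.ne', Real.rpow_one]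
      rw [this, hN', hN]
      refine Real.rpow_le_rpow (by positivity) ?_ (by positivity)
      have e1 := Real.rpow_le_rpow hd h3 hr.le
      have e2 := Real.rpow_le_rpow hd h4 hr.le
      linarith
  · refine (norm_add_le_norm_abs_sub_abs u v).trans (add_le_add_left ?_ _)
    rw [hN', hN]
    refine Real.rpow_le_rpow (by positivity) ?_ (by positivity)
    have e1 := Real.rpow_le_one (norm_nonneg _) h1 hr.le
    have e2 := Real.rpow_le_one (norm_nonneg _) h2 hr.le
    linarith

theorem norm_sub_bounds_of_norm_eq_one (hp : p ≠ ∞) {u v : Lp ℝ p μ} (hu : ‖u‖ = 1)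
    (hv : ‖v‖ = 1) :
    (2 : ℝ) ^ (1 / p.toReal) * (1 - ‖|u| ⊓ |v|‖) ≤ ‖u - v‖ ∧
      ‖u - v‖ ≤ (2 : ℝ) ^ (1 / p.toReal) + 2 * ‖|u| ⊓ |v|‖ := by
  simpa [sub_eq_add_neg] using
    norm_add_bounds_of_norm_eq_one hp hu (v := -v) (by rwa [norm_neg])

theorem mul_norm_inf_le {u v u' v' : Lp ℝ p μ} {m a b : ℝ} (hm : 0 ≤ m) (ha : m ≤ a) (hb : m ≤ b)
    (hu : u = a • u') (hv : v = b • v') : m * ‖|u'| ⊓ |v'|‖ ≤ ‖|u| ⊓ |v|‖ := by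
  have h : ‖m • (|u'| ⊓ |v'|)‖ ≤ ‖|u| ⊓ |v|‖ := by
    refine Lp.norm_le_norm_of_ae_le ?_
    filter_upwards [Lp.coeFn_abs u, Lp.coeFn_abs v, Lp.coeFn_abs u', Lp.coeFn_abs v',
      Lp.coeFn_inf |u| |v|, Lp.coeFn_inf |u'| |v'|, Lp.coeFn_smul m (|u'| ⊓ |v'|),
      Lp.coeFn_smul a u', Lp.coeFn_smul b v'] with x h1 h2 h3 h4 h5 h6 h7 h8 h9
    rw [h7, h5, Pi.smul_apply, h6, Pi.inf_apply, Pi.inf_apply, h1, h2, h3, h4, hu, hv, h8, h9,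
      Pi.smul_apply, Pi.smul_apply, smul_eq_mul, smul_eq_mul, smul_eq_mul, abs_mul, abs_mul,
      abs_of_nonneg (hm.trans ha), abs_of_nonneg (hm.trans hb), norm_mul, Real.norm_of_nonneg hm,
      Real.norm_of_nonneg (le_inf (abs_nonneg _) (abs_nonneg _))]
    refine le_trans ?_ (Real.le_norm_self _)
    refine le_inf ?_ ?_
    · exact mul_le_mul ha inf_le_left (le_inf (abs_nonneg _) (abs_nonneg _)) (hm.trans ha)
    · exact mul_le_mul hb inf_le_right (le_inf (abs_nonneg _) (abs_nonneg _)) (hm.trans hb)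
  rwa [norm_smul, Real.norm_of_nonneg hm] at h

/-- A subspace without almost disjoint normalized pairs does stable phase retrieval. -/
theorem doesSPR_of_forall_le_norm_inf {E : Submodule ℝ (Lp ℝ p μ)} {d : ℝ} (hd : 0 < d)
    (h : ∀ u ∈ E, ∀ v ∈ E, ‖u‖ = 1 → ‖v‖ = 1 → d ≤ ‖|u| ⊓ |v|‖) : DoesSPR E := by
  -- The hypothesis extends to all pairs by homogeneity, with the smaller norm as factor.
  have key : ∀ u ∈ E, ∀ v ∈ E, min ‖u‖ ‖v‖ * d ≤ ‖|u| ⊓ |v|‖ := by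
    intro u hu v hv
    rcases eq_or_ne u 0 with rfl | hu0
    · simp
    rcases eq_or_ne v 0 with rfl | hv0
    · simp
    have hu1 : ‖u‖ ≠ 0 := norm_ne_zero_iff.2 hu0
    have hv1 : ‖v‖ ≠ 0 := norm_ne_zero_iff.2 hv0
    refine le_trans ?_ (mul_norm_inf_le (m := min ‖u‖ ‖v‖) (u' := ‖u‖⁻¹ • u) (v' := ‖v‖⁻¹ • v)
      (by positivity) (min_le_left _ _) (min_le_right _ _)
      (by rw [smul_smul, mul_inv_cancel₀ hu1, one_smul])
      (by rw [smul_smul, mul_inv_cancel₀ hv1, one_smul]))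
    refine mul_le_mul_of_nonneg_left ?_ (by positivity)
    refine h _ (E.smul_mem _ hu) _ (E.smul_mem _ hv) ?_ ?_
    · rw [norm_smul, norm_inv, norm_norm, inv_mul_cancel₀ hu1]
    · rw [norm_smul, norm_inv, norm_norm, inv_mul_cancel₀ hv1]
  refine ⟨d⁻¹, inv_pos.2 hd, fun f hf g hg => ?_⟩
  -- The pair to test is `f + g`, `f - g`: its lattice infimum is `||f| - |g||`, and the smaller of
  -- its norms is the distance up to sign.
  have h1 := key _ (E.add_mem hf hg) _ (E.sub_mem hf hg)
  rw [← abs_abs_sub_abs_eq_inf, norm_abs_eq_norm] at h1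
  have h2 : ⨅ l : Metric.sphere (0 : ℝ) 1, ‖f - (l : ℝ) • g‖ ≤ min ‖f + g‖ ‖f - g‖ := by
    have hb : BddBelow (Set.range fun l : Metric.sphere (0 : ℝ) 1 => ‖f - (l : ℝ) • g‖) :=
      ⟨0, by rintro _ ⟨l, rfl⟩; exact norm_nonneg _⟩
    refine le_min ?_ ?_
    · refine (ciInf_le hb ⟨-1, by simp⟩).trans (le_of_eq ?_)
      simp
    · refine (ciInf_le hb ⟨1, by simp⟩).trans (le_of_eq ?_)
      simp
  refine h2.trans ?_
  rw [inv_mul_eq_div, le_div_iff₀ hd]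
  exact h1

end AlmostDisjoint

/-! ### Near-isometric copies of subspaces of `L_q` do SPR. -/

section Isomorphic

theorem doesSPR_of_isIsomorphicWith_of_lt_of_le_two {p q : ℝ≥0∞} [Fact (1 ≤ p)] [Fact (1 ≤ q)]
    (hpq : p < q) (hq : q ≤ 2) : ∃ ε : ℝ, 0 < ε ∧
      ∀ (E : Submodule ℝ (LpUnit p)) (F : Submodule ℝ (LpUnit q)),
        IsIsomorphicWith (1 + ε) E F → DoesSPR E := by
  have hp1 : 1 ≤ p := Fact.out
  have hp0 : p ≠ 0 := (zero_lt_one.trans_le hp1).ne'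
  have hp : p ≠ ∞ := (hpq.trans_le le_top).ne
  have hqt : q ≠ ∞ := (hq.trans_lt (by simp)).ne
  have hq0 : q ≠ 0 := (pos_of_gt hpq).ne'
  have hpr : 0 < p.toReal := ENNReal.toReal_pos hp0 hp
  have hqr : 0 < q.toReal := ENNReal.toReal_pos hq0 hqt
  have hlt : p.toReal < q.toReal := (ENNReal.toReal_lt_toReal hp hqt).2 hpq
  have h2 : (2 : ℝ) ^ (1 / q.toReal) < (2 : ℝ) ^ (1 / p.toReal) :=
    Real.rpow_lt_rpow_of_exponent_lt (by norm_num) (one_div_lt_one_div_of_lt hpr hlt)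
  set P : ℝ := (2 : ℝ) ^ (1 / p.toReal)
  set Q : ℝ := (2 : ℝ) ^ (1 / q.toReal) with hQ
  have hQ0 : 0 < Q := by positivity
  have hP0 : 0 < P := by positivity
  -- This `ε` makes `(1 + ε) Q` the midpoint of `P` and `Q`. Then `P (1 - δ) ≤ (P + Q) / 2` for the
  -- overlap `δ`, hence the lower bound `(P - Q) / (2 P)` used below.
  refine ⟨(P - Q) / (2 * Q), by apply div_pos <;> linarith, ?_⟩
  rintro E F ⟨T, hT⟩
  refine doesSPR_of_forall_le_norm_inf (d := (P - Q) / (2 * P)) (by apply div_pos <;> linarith)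
    fun u hu v hv hu1 hv1 => ?_
  set x : E := ⟨u, hu⟩
  set y : E := ⟨v, hv⟩
  set t := ‖(T : E →L[ℝ] F)‖
  set s := ‖(T.symm : F →L[ℝ] E)‖
  have ht : 0 ≤ t := norm_nonneg (T : E →L[ℝ] F)
  have hs : 0 ≤ s := norm_nonneg (T.symm : F →L[ℝ] E)
  have hx : ‖T x‖ ≤ t := by simpa [x, hu1] using (T : E →L[ℝ] F).le_opNorm x
  have hy : ‖T y‖ ≤ t := by simpa [y, hv1] using (T : E →L[ℝ] F).le_opNorm y
  have hsym : ∀ z : E, ‖z‖ ≤ s * ‖T z‖ := fun z => by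
    simpa using (T.symm : F →L[ℝ] E).le_opNorm (T z)
  have htype := norm_add_rpow_add_norm_sub_rpow_le hq0 hq (T x : LpUnit q) (T y : LpUnit q)
  -- Both of `x ± y` are large in `L_p`; by the type inequality the image of one of them is small in
  -- `L_q`.
  have hexists : ∃ z : E, P * (1 - ‖|u| ⊓ |v|‖) ≤ ‖z‖ ∧ ‖T z‖ ≤ Q * t := by
    have hle : ∀ z : F, ‖z‖ ^ q.toReal ≤ 2 * t ^ q.toReal → ‖z‖ ≤ Q * t := fun z hz => by
      have := Real.rpow_le_rpow (by positivity) hz (one_div_nonneg.2 hqr.le)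
      rwa [← Real.rpow_mul (norm_nonneg _), mul_one_div_cancel hqr.ne', Real.rpow_one,
        Real.mul_rpow (by norm_num) (by positivity), ← Real.rpow_mul ht,
        mul_one_div_cancel hqr.ne', Real.rpow_one] at this
    have ex := Real.rpow_le_rpow (norm_nonneg _) hx hqr.le
    have ey := Real.rpow_le_rpow (norm_nonneg _) hy hqr.le
    have e1 : ‖(T x : LpUnit q) + T y‖ = ‖T (x + y)‖ := by rw [map_add]; rfl
    have e2 : ‖(T x : LpUnit q) - T y‖ = ‖T (x - y)‖ := by rw [map_sub]; rfl
    rw [e1, e2] at htype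
    change _ ≤ 2 * (‖T x‖ ^ q.toReal + ‖T y‖ ^ q.toReal) at htype
    rcases le_total (‖T (x + y)‖ ^ q.toReal) (‖T (x - y)‖ ^ q.toReal) with h | h
    · exact ⟨x + y, (norm_add_bounds_of_norm_eq_one hp hu1 hv1).1, hle _ (by linarith)⟩
    · exact ⟨x - y, (norm_sub_bounds_of_norm_eq_one hp hu1 hv1).1, hle _ (by linarith)⟩
  obtain ⟨z, hz1, hz2⟩ := hexists
  have h3 : P * (1 - ‖|u| ⊓ |v|‖) ≤ Q * (1 + (P - Q) / (2 * Q)) :=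
    calc _ ≤ s * ‖T z‖ := hz1.trans (hsym z)
      _ ≤ s * (Q * t) := by gcongr
      _ = Q * (t * s) := by ring
      _ ≤ _ := by gcongr
  have h4 : Q * (1 + (P - Q) / (2 * Q)) = (P + Q) / 2 := by field_simp; ring
  rw [div_le_iff₀ (by positivity)]
  linarith

theorem doesSPR_of_isIsomorphicWith_two {p : ℝ≥0∞} [Fact (1 ≤ p)]
    (hp2 : 2 < p) (hp : p ≠ ∞) : ∃ ε : ℝ, 0 < ε ∧
      ∀ (E : Submodule ℝ (LpUnit p)) (F : Submodule ℝ (LpUnit 2)),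
        IsIsomorphicWith (1 + ε) E F → DoesSPR E := by
  have hlt : (2 : ℝ) < p.toReal := by
    simpa using (ENNReal.toReal_lt_toReal (by simp) hp).2 hp2
  have h2 : (2 : ℝ) ^ (1 / p.toReal) < (2 : ℝ) ^ (1 / 2 : ℝ) :=
    Real.rpow_lt_rpow_of_exponent_lt (by norm_num) (one_div_lt_one_div_of_lt (by norm_num) hlt)
  set P : ℝ := (2 : ℝ) ^ (1 / p.toReal)
  set Q : ℝ := (2 : ℝ) ^ (1 / 2 : ℝ) with hQ
  have hQ0 : 0 < Q := by positivity
  have hP0 : 0 < P := by positivity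
  have hQ2 : Q ^ 2 = 2 := by rw [hQ, ← Real.sqrt_eq_rpow]; norm_num
  have hε : 0 < (Q - P) / (2 * P) := by apply div_pos <;> linarith
  -- Now `(1 + ε) P` is the midpoint, so `Q ≤ (P + Q) / 2 + 2 (1 + ε) δ` for the overlap `δ`, which
  -- gives the bound `(Q - P) / (4 (1 + ε))`.
  refine ⟨(Q - P) / (2 * P), hε, ?_⟩
  set ε := (Q - P) / (2 * P) with hεdef
  rintro E F ⟨T, hT⟩
  refine doesSPR_of_forall_le_norm_inf (d := (Q - P) / (4 * (1 + ε)))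
    (by apply div_pos <;> linarith) fun u hu v hv hu1 hv1 => ?_
  set x : E := ⟨u, hu⟩
  set y : E := ⟨v, hv⟩
  set t := ‖(T : E →L[ℝ] F)‖
  set s := ‖(T.symm : F →L[ℝ] E)‖
  have ht : 0 ≤ t := norm_nonneg (T : E →L[ℝ] F)
  have hs : 0 ≤ s := norm_nonneg (T.symm : F →L[ℝ] E)
  have hle : ∀ z : E, ‖T z‖ ≤ t * ‖z‖ := (T : E →L[ℝ] F).le_opNorm
  have hsym : ∀ z : E, ‖z‖ ≤ s * ‖T z‖ := fun z => by
    simpa using (T.symm : F →L[ℝ] E).le_opNorm (T z)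
  have hx : 1 ≤ s * ‖T x‖ := by simpa [x, hu1] using hsym x
  have hy : 1 ≤ s * ‖T y‖ := by simpa [y, hv1] using hsym y
  have hpar := parallelogram_law_with_norm ℝ (T x : LpUnit 2) (T y : LpUnit 2)
  have e1 : ‖(T x : LpUnit 2) + T y‖ = ‖T (x + y)‖ := by rw [map_add]; rfl
  have e2 : ‖(T x : LpUnit 2) - T y‖ = ‖T (x - y)‖ := by rw [map_sub]; rfl
  rw [e1, e2] at hpar
  change _ = 2 * (‖T x‖ ^ 2 + ‖T y‖ ^ 2) at hpar
  have hx2 : 1 ≤ s ^ 2 * ‖T x‖ ^ 2 := by nlinarith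
  have hy2 : 1 ≤ s ^ 2 * ‖T y‖ ^ 2 := by nlinarith
  -- The roles are reversed: both of `x ± y` are small in `L_p`, and the parallelogram law makes one
  -- image large.
  have hexists : ∃ z : E, ‖z‖ ≤ P + 2 * ‖|u| ⊓ |v|‖ ∧ 2 ≤ (s * ‖T z‖) ^ 2 := by
    have hpar' : s ^ 2 * ‖T (x + y)‖ ^ 2 + s ^ 2 * ‖T (x - y)‖ ^ 2
        = 2 * (s ^ 2 * ‖T x‖ ^ 2 + s ^ 2 * ‖T y‖ ^ 2) := by linear_combination s ^ 2 * hpar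
    rcases le_total (s ^ 2 * ‖T (x + y)‖ ^ 2) (s ^ 2 * ‖T (x - y)‖ ^ 2) with h | h
    · exact ⟨x - y, (norm_sub_bounds_of_norm_eq_one hp hu1 hv1).2, by rw [mul_pow]; linarith⟩
    · exact ⟨x + y, (norm_add_bounds_of_norm_eq_one hp hu1 hv1).2, by rw [mul_pow]; linarith⟩
  obtain ⟨z, hz1, hz2⟩ := hexists
  have h3 : Q ≤ s * ‖T z‖ := by
    rw [← hQ2] at hz2
    exact le_of_sq_le_sq hz2 (by positivity)
  have h4 : Q ≤ (1 + ε) * (P + 2 * ‖|u| ⊓ |v|‖) :=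
    calc Q ≤ s * ‖T z‖ := h3
      _ ≤ s * (t * ‖z‖) := by gcongr; exact hle z
      _ = (t * s) * ‖z‖ := by ring
      _ ≤ _ := by gcongr
  have h5 : (1 + ε) * P = (P + Q) / 2 := by rw [hεdef]; field_simp; ring
  rw [div_le_iff₀ (by positivity)]
  linarith

end Isomorphic

/-! ### Integrals that represent powers. -/

section PowerIntegral

theorem setLIntegral_Ioi_comp_mul_left {f : ℝ → ℝ≥0∞} (hf : Measurable f) {c : ℝ} (hc : 0 < c) :
    ∫⁻ x in Set.Ioi 0, f (c * x) = ENNReal.ofReal c⁻¹ * ∫⁻ x in Set.Ioi 0, f x := by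
  have h := setLIntegral_map (μ := volume) (g := fun x : ℝ => c * x)
    (measurableSet_Ioi (a := (0 : ℝ))) hf (measurable_const_mul c)
  rw [Real.map_volume_mul_left hc.ne', Measure.restrict_smul, lintegral_smul_measure,
    abs_of_pos (inv_pos.2 hc)] at h
  have hs : (fun x : ℝ => c * x) ⁻¹' Set.Ioi 0 = Set.Ioi 0 := by
    ext x
    simp [hc]
  rw [hs] at h
  rw [← h, smul_eq_mul]

/-- The integral `∫₀^∞ (1 - exp (-D x ^ a)) x ^ (-1 - b) dx`. -/
noncomputable def expPowerIntegral (a b D : ℝ) : ℝ≥0∞ :=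
  ∫⁻ x in Set.Ioi (0 : ℝ), ENNReal.ofReal ((1 - Real.exp (-(D * x ^ a))) * x ^ (-1 - b))

theorem measurable_expPowerIntegrand (a b D : ℝ) :
    Measurable fun x : ℝ => ENNReal.ofReal ((1 - Real.exp (-(D * x ^ a))) * x ^ (-1 - b)) := by
  fun_prop

/-- The substitution `x ↦ D ^ (1 / a) x` absorbs `D`. This expresses a power of `D` as a mixture of
exponentials, hence fractional moments through Laplace transforms. -/
theorem expPowerIntegral_eq {a b D : ℝ} (ha : a ≠ 0) (hD : 0 < D) :
    expPowerIntegral a b D = ENNReal.ofReal (D ^ (b / a)) * expPowerIntegral a b 1 := by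
  set c : ℝ := D ^ (1 / a) with hc
  have hc0 : 0 < c := Real.rpow_pos_of_pos hD _
  have hca : c ^ a = D := by
    rw [hc, ← Real.rpow_mul hD.le, one_div_mul_cancel ha, Real.rpow_one]
  have hcb : D ^ (b / a) = c ^ b := by
    rw [hc, ← Real.rpow_mul hD.le]; congr 1; ring
  have h := setLIntegral_Ioi_comp_mul_left (measurable_expPowerIntegrand a b 1) hc0
  have h2 : ∫⁻ x in Set.Ioi (0 : ℝ), ENNReal.ofReal
        ((1 - Real.exp (-(1 * (c * x) ^ a))) * (c * x) ^ (-1 - b)) =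
      ENNReal.ofReal (c ^ (-1 - b)) * expPowerIntegral a b D := by
    rw [expPowerIntegral, ← lintegral_const_mul _ (measurable_expPowerIntegrand a b D)]
    refine setLIntegral_congr_fun measurableSet_Ioi fun x hx => ?_
    have hx : 0 < x := hx
    rw [← ENNReal.ofReal_mul (by positivity), Real.mul_rpow hc0.le hx.le,
      Real.mul_rpow hc0.le hx.le, hca, one_mul]
    congr 1
    ring
  rw [h2] at h
  have h3 : ENNReal.ofReal (c ^ (1 + b)) * ENNReal.ofReal (c ^ (-1 - b)) = 1 := by
    rw [← ENNReal.ofReal_mul (by positivity), ← Real.rpow_add hc0]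
    norm_num
  have h4 : ENNReal.ofReal (c ^ (1 + b)) * ENNReal.ofReal c⁻¹ = ENNReal.ofReal (c ^ b) := by
    rw [← ENNReal.ofReal_mul (by positivity), ← Real.rpow_neg_one, ← Real.rpow_add hc0]
    norm_num
  rw [hcb, ← h4, mul_assoc]
  change _ = _ * (_ * ∫⁻ x in Set.Ioi (0 : ℝ), _)
  rw [← h, ← mul_assoc, h3, one_mul]

theorem expPowerIntegral_zero (a b : ℝ) : expPowerIntegral a b 0 = 0 := by
  simp [expPowerIntegral]

theorem expPowerIntegral_eq_of_nonneg {a b D : ℝ} (hab : 0 < b / a) (hD : 0 ≤ D) :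
    expPowerIntegral a b D = ENNReal.ofReal (D ^ (b / a)) * expPowerIntegral a b 1 := by
  rcases hD.eq_or_lt with rfl | hD
  · rw [expPowerIntegral_zero, Real.zero_rpow hab.ne', ENNReal.ofReal_zero, zero_mul]
  · exact expPowerIntegral_eq (fun h => by simp [h] at hab) hD

theorem expPowerIntegral_one_pos (a b : ℝ) : expPowerIntegral a b 1 ≠ 0 := by
  have hae : AEMeasurable (fun x : ℝ => ENNReal.ofReal
      ((1 - Real.exp (-(1 * x ^ a))) * x ^ (-1 - b))) (volume.restrict (Set.Ioi 0)) :=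
    (measurable_expPowerIntegrand a b 1).aemeasurable
  intro h
  rw [expPowerIntegral, lintegral_eq_zero_iff' hae] at h
  have hF : ∀ᵐ x ∂(volume.restrict (Set.Ioi (0 : ℝ))), False := by
    filter_upwards [h, ae_restrict_mem measurableSet_Ioi] with x hx hx0
    have hx0 : 0 < x := hx0
    have h1 : Real.exp (-(1 * x ^ a)) < 1 := by
      rw [Real.exp_lt_one_iff]
      have := Real.rpow_pos_of_pos hx0 a
      linarith
    have h2 : 0 < (1 - Real.exp (-(1 * x ^ a))) * x ^ (-1 - b) :=
      mul_pos (by linarith) (Real.rpow_pos_of_pos hx0 _)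
    exact h2.not_ge (ENNReal.ofReal_eq_zero.1 hx)
  have := Filter.eventually_false_iff_eq_bot.1 hF
  rw [ae_eq_bot, Measure.restrict_eq_zero] at this
  simp at this

theorem lintegral_rpow_Ioc_lt_top {s : ℝ} (hs : -1 < s) :
    ∫⁻ x in Set.Ioc (0 : ℝ) 1, ENNReal.ofReal (x ^ s) < ∞ := by
  have := intervalIntegral.intervalIntegrable_rpow' (a := 0) (b := 1) hs
  rw [intervalIntegrable_iff_integrableOn_Ioc_of_le zero_le_one] at this
  exact this.lintegral_lt_top

theorem lintegral_rpow_Ioi_lt_top {t : ℝ} (ht : t < -1) :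
    ∫⁻ x in Set.Ioi (1 : ℝ), ENNReal.ofReal (x ^ t) < ∞ :=
  (integrableOn_Ioi_rpow_of_lt ht zero_lt_one).lintegral_lt_top

/-- The factor `1 - exp (-x ^ a)` is at most `1` and at most `x ^ a`. One bound is integrable near
zero and the other near infinity; the sign of `a` decides which. -/
theorem expPowerIntegral_one_lt_top {a b : ℝ} (h : (0 < b ∧ b < a) ∨ (a < b ∧ b < 0)) :
    expPowerIntegral a b 1 < ∞ := by
  have hb1 : ∀ x : ℝ, 0 < x → (1 - Real.exp (-(1 * x ^ a))) * x ^ (-1 - b) ≤ x ^ (-1 - b) := by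
    intro x hx
    have h1 := Real.exp_pos (-(1 * x ^ a))
    have h2 := Real.rpow_pos_of_pos hx (-1 - b)
    nlinarith
  have hb2 : ∀ x : ℝ, 0 < x → (1 - Real.exp (-(1 * x ^ a))) * x ^ (-1 - b) ≤ x ^ (a - 1 - b) := by
    intro x hx
    have h1 := Real.add_one_le_exp (-(1 * x ^ a))
    have h2 := Real.rpow_pos_of_pos hx (-1 - b)
    have h3 : x ^ (a - 1 - b) = x ^ a * x ^ (-1 - b) := by
      rw [← Real.rpow_add hx]; congr 1; ring
    rw [h3]
    exact mul_le_mul_of_nonneg_right (by linarith) h2.le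
  rw [expPowerIntegral, ← Set.Ioc_union_Ioi_eq_Ioi zero_le_one]
  refine (lintegral_union_le _ _ _).trans_lt ?_
  rw [ENNReal.add_lt_top]
  have hu : ∀ (S : Set ℝ) (r : ℝ), MeasurableSet S → S ⊆ Set.Ioi 0 →
      (∀ x : ℝ, 0 < x → (1 - Real.exp (-(1 * x ^ a))) * x ^ (-1 - b) ≤ x ^ r) →
      ∫⁻ x in S, ENNReal.ofReal ((1 - Real.exp (-(1 * x ^ a))) * x ^ (-1 - b)) ≤
        ∫⁻ x in S, ENNReal.ofReal (x ^ r) := fun S r hS hsub hr =>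
    setLIntegral_mono' hS fun x hx => ENNReal.ofReal_le_ofReal (hr x (hsub hx))
  have hI1 : Set.Ioc (0 : ℝ) 1 ⊆ Set.Ioi 0 := Set.Ioc_subset_Ioi_self
  have hI2 : Set.Ioi (1 : ℝ) ⊆ Set.Ioi 0 := Set.Ioi_subset_Ioi zero_le_one
  rcases h with ⟨h0, h1⟩ | ⟨h0, h1⟩
  · exact ⟨(hu _ _ measurableSet_Ioc hI1 hb2).trans_lt (lintegral_rpow_Ioc_lt_top (by linarith)),
      (hu _ _ measurableSet_Ioi hI2 hb1).trans_lt (lintegral_rpow_Ioi_lt_top (by linarith))⟩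
  · exact ⟨(hu _ _ measurableSet_Ioc hI1 hb1).trans_lt (lintegral_rpow_Ioc_lt_top (by linarith)),
      (hu _ _ measurableSet_Ioi hI2 hb2).trans_lt (lintegral_rpow_Ioi_lt_top (by linarith))⟩

end PowerIntegral

/-! ### Independent Gaussian variables and their absolute moments. -/

section Gaussian

open ProbabilityTheory
open scoped NNReal

variable {ι : Type*}

/-- The product over `ι` of standard Gaussian measures. -/
noncomputable def gaussianPi (ι : Type*) : Measure (ι → ℝ) :=
  Measure.infinitePi fun _ : ι => gaussianReal 0 1

instance : IsProbabilityMeasure (gaussianPi ι) := by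
  unfold gaussianPi; infer_instance

theorem gaussianPi_map_sum (s : Finset ι) (a : ι → ℝ) :
    (gaussianPi ι).map (fun γ => ∑ i ∈ s, a i * γ i) =
      gaussianReal 0 (∑ i ∈ s, Real.nnabs (a i) ^ 2) := by
  classical
  have hind : iIndepFun (fun i (γ : ι → ℝ) => a i * γ i) (gaussianPi ι) :=
    iIndepFun_infinitePi (X := fun i x => a i * x) fun i => measurable_const_mul _
  have hm : ∀ i, Measurable fun γ : ι → ℝ => a i * γ i := fun i => by fun_prop
  have hone : ∀ i, (gaussianPi ι).map (fun γ => a i * γ i) =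
      gaussianReal 0 (Real.nnabs (a i) ^ 2) := by
    intro i
    have h : (gaussianPi ι).map (fun γ => γ i) = gaussianReal 0 1 :=
      Measure.infinitePi_map_eval (fun _ : ι => gaussianReal 0 1) i
    have h2 : (fun γ : ι → ℝ => a i * γ i) = (fun x => a i * x) ∘ fun γ => γ i := rfl
    rw [h2, ← Measure.map_map (by fun_prop) (by fun_prop), h, gaussianReal_map_const_mul]
    congr 1
    · simp
    · ext; simp
  induction s using Finset.induction_on with
  | empty => simp
  | insert i s hi ih =>
    have h1 : (fun γ : ι → ℝ => ∑ j ∈ insert i s, a j * γ j) =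
        (∑ j ∈ s, fun γ : ι → ℝ => a j * γ j) + fun γ => a i * γ i := by
      ext γ
      simp [Finset.sum_insert hi, add_comm]
    have h2 : (∑ j ∈ s, fun γ : ι → ℝ => a j * γ j) = fun γ => ∑ j ∈ s, a j * γ j := by
      ext γ; simp
    have h3 := hind.indepFun_finsetSum_of_notMem hm hi
    rw [h1, gaussianReal_add_gaussianReal_of_indepFun h3 (by rw [h2]; exact ih) (hone i),
      Finset.sum_insert hi, add_comm (_ ^ 2), add_zero]

/-- The absolute moment of order `r` of a standard Gaussian variable. -/
noncomputable def gaussianAbsMoment (r : ℝ) : ℝ≥0∞ := ∫⁻ x, ‖x‖ₑ ^ r ∂gaussianReal 0 1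

theorem gaussianAbsMoment_lt_top {r : ℝ} (hr : 0 < r) : gaussianAbsMoment r < ∞ := by
  have h := (memLp_id_gaussianReal (μ := 0) (v := 1) r.toNNReal).eLpNorm_lt_top
  rw [eLpNorm_lt_top_iff_lintegral_rpow_enorm_lt_top (by simpa using hr) (by simp)] at h
  simpa [gaussianAbsMoment, hr.le] using h

theorem gaussianAbsMoment_ne_zero {r : ℝ} (hr : 0 < r) : gaussianAbsMoment r ≠ 0 := by
  intro h
  rw [gaussianAbsMoment, lintegral_eq_zero_iff (by fun_prop)] at h
  have h0 : ∀ᵐ x ∂gaussianReal 0 1, x ∈ ({0} : Set ℝ) := by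
    filter_upwards [h] with x hx
    simpa [ENNReal.rpow_eq_zero_iff, hr, hr.not_gt] using hx
  have hn := nullSingletonClass_gaussianReal (μ := 0) (v := 1) one_ne_zero
  have h1 : gaussianReal 0 1 ({0} : Set ℝ) = 0 := measure_singleton 0
  have h2 : ∀ᵐ x ∂gaussianReal 0 1, False := by
    filter_upwards [h0, measure_eq_zero_iff_ae_notMem.1 h1] with x a b using b a
  have := Filter.eventually_false_iff_eq_bot.1 h2
  exact (ae_neBot.2 (IsProbabilityMeasure.ne_zero _)).ne this

theorem lintegral_enorm_rpow_gaussianReal (v : ℝ≥0) {r : ℝ} (hr : 0 ≤ r) :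
    ∫⁻ x, ‖x‖ₑ ^ r ∂gaussianReal 0 v = (v : ℝ≥0∞) ^ (r / 2) * gaussianAbsMoment r := by
  have h : gaussianReal 0 v = (gaussianReal 0 1).map fun x => (NNReal.sqrt v : ℝ) * x := by
    rw [gaussianReal_map_const_mul]
    congr 1
    · simp
    · ext; simp
  rw [h, lintegral_map (by fun_prop) (by fun_prop), gaussianAbsMoment,
    ← lintegral_const_mul _ (by fun_prop)]
  refine lintegral_congr fun x => ?_
  rw [enorm_mul, ENNReal.mul_rpow_of_nonneg _ _ hr]
  congr 1
  rw [← ofReal_norm, Real.norm_of_nonneg (NNReal.coe_nonneg _), ENNReal.ofReal_coe_nnreal,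
    NNReal.sqrt_eq_rpow, ← ENNReal.coe_rpow_of_nonneg _ hr, ← NNReal.rpow_mul,
    ← ENNReal.coe_rpow_of_nonneg _ (by positivity)]
  congr 2
  ring

theorem lintegral_enorm_sum_rpow_gaussianPi (s : Finset ι) (a : ι → ℝ) {r : ℝ} (hr : 0 ≤ r) :
    ∫⁻ γ, ‖∑ i ∈ s, a i * γ i‖ₑ ^ r ∂gaussianPi ι =
      (∑ i ∈ s, ‖a i‖ₑ ^ 2) ^ (r / 2) * gaussianAbsMoment r := by
  have h := lintegral_map (μ := gaussianPi ι) (f := fun x : ℝ => ‖x‖ₑ ^ r)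
    (g := fun γ : ι → ℝ => ∑ i ∈ s, a i * γ i) (by fun_prop) (by fun_prop)
  rw [← h, gaussianPi_map_sum, lintegral_enorm_rpow_gaussianReal _ hr]
  congr 2
  push_cast
  rfl

end Gaussian

/-! ### From `L_p(ℓ_2)` norms to isometric embeddings in `L_p[0,1]`. -/

section Embedding

open Filter Topology

variable {V : Type*} [NormedAddCommGroup V] [NormedSpace ℝ V] {Ω : Type*} [MeasurableSpace Ω]
  {P : Measure Ω} {ι : Type*} [Countable ι] {p : ℝ≥0∞}

/-- Gaussian randomization preserves `L_p(ℓ_2)` norms, up to a constant. -/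
theorem lintegral_gaussian_sum_rpow {G : ι → Ω → ℝ} (hG : ∀ i, Measurable (G i)) (s : Finset ι)
    {r : ℝ} (hr : 0 ≤ r) :
    ∫⁻ z, ‖∑ i ∈ s, G i z.1 * z.2 i‖ₑ ^ r ∂(P.prod (gaussianPi ι)) =
      gaussianAbsMoment r * ∫⁻ ω, (∑ i ∈ s, ‖G i ω‖ₑ ^ 2) ^ (r / 2) ∂P := by
  rw [lintegral_prod _ (by fun_prop), ← lintegral_const_mul _ (by fun_prop)]
  refine lintegral_congr fun ω => ?_
  rw [mul_comm]
  exact lintegral_enorm_sum_rpow_gaussianPi s (fun i => G i ω) hr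

theorem tendsto_lintegral_sum_rpow {G : ι → Ω → ℝ} (hG : ∀ i, Measurable (G i)) {r : ℝ}
    (hr : 0 < r) (hfin : ∫⁻ ω, (∑' i, ‖G i ω‖ₑ ^ 2) ^ r ∂P ≠ ∞) :
    Tendsto (fun s : Finset ι => ∫⁻ ω, (∑ i ∈ s, ‖G i ω‖ₑ ^ 2) ^ r ∂P) atTop
      (𝓝 (∫⁻ ω, (∑' i, ‖G i ω‖ₑ ^ 2) ^ r ∂P)) := by
  refine tendsto_lintegral_filter_of_dominated_convergence (fun ω => (∑' i, ‖G i ω‖ₑ ^ 2) ^ r)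
    (Eventually.of_forall fun s => by fun_prop) (Eventually.of_forall fun s => ?_) hfin ?_
  · exact ae_of_all _ fun ω => ENNReal.rpow_le_rpow (ENNReal.sum_le_tsum s) hr.le
  · exact ae_of_all _ fun ω =>
      (ENNReal.continuous_rpow_const.tendsto _).comp ENNReal.summable.hasSum

theorem tendsto_lintegral_tsum_compl_rpow {G : ι → Ω → ℝ} (hG : ∀ i, Measurable (G i)) {r : ℝ}
    (hr : 0 < r) (hfin : ∫⁻ ω, (∑' i, ‖G i ω‖ₑ ^ 2) ^ r ∂P ≠ ∞) :
    Tendsto (fun s : Finset ι => ∫⁻ ω, (∑' i : {i // i ∉ s}, ‖G i ω‖ₑ ^ 2) ^ r ∂P) atTop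
      (𝓝 0) := by
  have hm : Measurable fun ω => (∑' i, ‖G i ω‖ₑ ^ 2) ^ r := by fun_prop
  rw [← lintegral_zero (μ := P)]
  refine tendsto_lintegral_filter_of_dominated_convergence (fun ω => (∑' i, ‖G i ω‖ₑ ^ 2) ^ r)
    (Eventually.of_forall fun s => by fun_prop) (Eventually.of_forall fun s => ?_) hfin ?_
  · exact ae_of_all _ fun ω => ENNReal.rpow_le_rpow
      (ENNReal.tsum_comp_le_tsum_of_injective Subtype.val_injective _) hr.le
  · filter_upwards [ae_lt_top hm hfin] with ω hω
    have h0 : (∑' i, ‖G i ω‖ₑ ^ 2) ≠ ∞ := fun h => by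
      rw [h, ENNReal.top_rpow_of_pos hr] at hω
      exact lt_irrefl _ hω
    have := (ENNReal.continuous_rpow_const (y := r)).tendsto 0 |>.comp
      (ENNReal.tendsto_tsum_compl_atTop_zero h0)
    rwa [ENNReal.zero_rpow_of_pos hr] at this

/-- A normed space whose norm is an `L_p(ℓ_2)` norm, up to a constant, through coordinates that are
almost everywhere linear, embeds linearly isometrically into `L_p[0,1]`. -/
theorem exists_linearIsometry_LpUnit [IsProbabilityMeasure P] [StandardBorelSpace Ω]
    [Fact (1 ≤ p)] (hp : p ≠ ∞)
    {F : ι → V → Ω → ℝ} (hF : ∀ i v, Measurable (F i v))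
    (hadd : ∀ i v w, F i (v + w) =ᵐ[P] F i v + F i w)
    (hsmul : ∀ i (c : ℝ) v, F i (c • v) =ᵐ[P] c • F i v)
    {K : ℝ≥0∞} (hK0 : K ≠ 0) (hK : K ≠ ∞)
    (h : ∀ v, ∫⁻ ω, (∑' i, ‖F i v ω‖ₑ ^ 2) ^ (p.toReal / 2) ∂P = K * ‖v‖ₑ ^ p.toReal) :
    Nonempty (V →ₗᵢ[ℝ] LpUnit p) := by
  classical
  have hp0 : p ≠ 0 := (zero_lt_one.trans_le Fact.out).ne'
  have hr : 0 < p.toReal := ENNReal.toReal_pos hp0 hp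
  set r := p.toReal with hrdef
  set Q := P.prod (gaussianPi ι) with hQ
  set M := gaussianAbsMoment r with hM
  have hM0 : M ≠ 0 := gaussianAbsMoment_ne_zero hr
  have hMt : M ≠ ∞ := (gaussianAbsMoment_lt_top hr).ne
  have hfin : ∀ v, ∫⁻ ω, (∑' i, ‖F i v ω‖ₑ ^ 2) ^ (r / 2) ∂P ≠ ∞ := fun v => by
    rw [h]
    exact ENNReal.mul_ne_top hK (ENNReal.rpow_ne_top_of_nonneg hr.le enorm_ne_top)
  -- Only finite Gaussian sums are formed; the infinite series is taken as a limit in `L_p`, which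
  -- keeps linearity in `v`.
  set X : Finset ι → V → Ω × (ι → ℝ) → ℝ := fun s v z => ∑ i ∈ s, F i v z.1 * z.2 i with hX
  have hXm : ∀ s v, Measurable (X s v) := fun s v => by
    have := hF
    fun_prop
  have hXint : ∀ s v, ∫⁻ z, ‖X s v z‖ₑ ^ r ∂Q =
      M * ∫⁻ ω, (∑ i ∈ s, ‖F i v ω‖ₑ ^ 2) ^ (r / 2) ∂P := fun s v =>
    lintegral_gaussian_sum_rpow (fun i => hF i v) s hr.le
  have hmem : ∀ s v, MemLp (X s v) p Q := fun s v => by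
    refine ⟨(hXm s v).aestronglyMeasurable, ?_⟩
    rw [eLpNorm_lt_top_iff_lintegral_rpow_enorm_lt_top hp0 hp, hXint]
    refine ENNReal.mul_lt_top hMt.lt_top (lt_of_le_of_lt ?_ (hfin v).lt_top)
    exact lintegral_mono fun ω => ENNReal.rpow_le_rpow (ENNReal.sum_le_tsum s) (by positivity)
  set Y : Finset ι → V → Lp ℝ p Q := fun s v => (hmem s v).toLp (X s v) with hY
  have hYnorm : ∀ s v, ‖Y s v‖ₑ ^ r =
      M * ∫⁻ ω, (∑ i ∈ s, ‖F i v ω‖ₑ ^ 2) ^ (r / 2) ∂P := fun s v => by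
    rw [Lp_enorm_rpow hp0 hp, ← hXint]
    refine lintegral_congr_ae ?_
    filter_upwards [(hmem s v).coeFn_toLp] with z hz
    rw [hY, hz]
  have hQP : ∀ {q : Ω → Prop}, (∀ᵐ ω ∂P, q ω) → ∀ᵐ z ∂Q, q z.1 := fun hq =>
    Measure.quasiMeasurePreserving_fst.ae hq
  have hYadd : ∀ s v w, Y s (v + w) = Y s v + Y s w := fun s v w => by
    rw [hY, ← MemLp.toLp_add]
    refine MemLp.toLp_congr _ _ ?_
    filter_upwards [hQP (ae_all_iff.2 fun i => hadd i v w)] with z hz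
    simp only [hX, Pi.add_apply, ← Finset.sum_add_distrib]
    exact Finset.sum_congr rfl fun i _ => by rw [hz i, Pi.add_apply, add_mul]
  have hYsmul : ∀ s (c : ℝ) v, Y s (c • v) = c • Y s v := fun s c v => by
    rw [hY, ← MemLp.toLp_const_smul]
    refine MemLp.toLp_congr _ _ ?_
    filter_upwards [hQP (ae_all_iff.2 fun i => hsmul i c v)] with z hz
    simp only [hX, Pi.smul_apply, Finset.smul_sum]
    exact Finset.sum_congr rfl fun i _ => by
      rw [hz i, Pi.smul_apply, smul_eq_mul, smul_eq_mul, mul_assoc]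
  have hYsub : ∀ {s t} v, s ⊆ t → Y t v - Y s v = Y (t \ s) v := fun {s t} v hst => by
    rw [hY, ← MemLp.toLp_sub]
    refine MemLp.toLp_congr _ _ (ae_of_all _ fun z => ?_)
    simp only [hX, Pi.sub_apply]
    rw [← Finset.sum_sdiff hst, add_sub_cancel_right]
  -- The sum over `t \ s` is bounded by the tail integral off `s`, which tends to zero.
  have hcauchy : ∀ v, CauchySeq fun s => Y s v := fun v => by
    rw [Metric.cauchySeq_iff']
    intro ε hε
    have ht := tendsto_lintegral_tsum_compl_rpow (fun i => hF i v) (half_pos hr) (hfin v)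
    have ht' := ENNReal.Tendsto.const_mul ht (Or.inr hMt)
    rw [mul_zero] at ht'
    have hε' : 0 < ENNReal.ofReal ε ^ r :=
      ENNReal.rpow_pos (ENNReal.ofReal_pos.2 hε) ENNReal.ofReal_ne_top
    obtain ⟨s, hs⟩ := (ht'.eventually (gt_mem_nhds hε')).exists
    refine ⟨s, fun t hst => ?_⟩
    rw [dist_eq_norm, hYsub v hst]
    have h1 : ‖Y (t \ s) v‖ₑ ^ r < ENNReal.ofReal ε ^ r := by
      rw [hYnorm]
      refine lt_of_le_of_lt ?_ hs
      gcongr with ω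
      have h2 : ∑ i ∈ t \ s, ‖F i v ω‖ₑ ^ 2 =
          ∑ i ∈ (t \ s).subtype (· ∉ s), ‖F i v ω‖ₑ ^ 2 := by
        rw [Finset.sum_subtype_of_mem (fun i => ‖F i v ω‖ₑ ^ 2)
          fun i hi => (Finset.mem_sdiff.1 hi).2]
      rw [h2]
      exact ENNReal.sum_le_tsum _
    rw [ENNReal.rpow_lt_rpow_iff hr, ← ofReal_norm] at h1
    exact (ENNReal.ofReal_lt_ofReal_iff hε).1 h1
  choose Z hZ using fun v => cauchySeq_tendsto_of_complete (hcauchy v)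
  have hZadd : ∀ v w, Z (v + w) = Z v + Z w := fun v w => by
    refine tendsto_nhds_unique (hZ (v + w)) ?_
    simp only [hYadd]
    exact (hZ v).add (hZ w)
  have hZsmul : ∀ (c : ℝ) v, Z (c • v) = c • Z v := fun c v => by
    refine tendsto_nhds_unique (hZ (c • v)) ?_
    simp only [hYsmul]
    exact (hZ v).const_smul c
  have hZnorm : ∀ v, ‖Z v‖ₑ ^ r = M * K * ‖v‖ₑ ^ r := fun v => by
    have h1 : Tendsto (fun s => ‖Y s v‖ₑ ^ r) atTop (𝓝 (‖Z v‖ₑ ^ r)) :=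
      (ENNReal.continuous_rpow_const.tendsto _).comp (hZ v).enorm
    refine tendsto_nhds_unique h1 ?_
    simp only [hYnorm]
    rw [mul_assoc, ← h]
    exact ENNReal.Tendsto.const_mul
      (tendsto_lintegral_sum_rpow (fun i => hF i v) (half_pos hr) (hfin v)) (Or.inr hMt)
  set c : ℝ := ((M * K) ^ (1 / r)).toReal with hc
  have hMK0 : M * K ≠ 0 := mul_ne_zero hM0 hK0
  have hMK : M * K ≠ ∞ := ENNReal.mul_ne_top hMt hK
  have hc0 : 0 < c := ENNReal.toReal_pos (by simp [ENNReal.rpow_eq_zero_iff, hMK0, hMK])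
    (ENNReal.rpow_ne_top_of_nonneg (by positivity) hMK)
  have hZnorm' : ∀ v, ‖Z v‖ = c * ‖v‖ := fun v => by
    have h1 := congrArg (fun x => (x ^ (1 / r)).toReal) (hZnorm v)
    rw [ENNReal.mul_rpow_of_nonneg _ _ (by positivity), ← ENNReal.rpow_mul, ← ENNReal.rpow_mul,
      mul_one_div_cancel hr.ne', ENNReal.rpow_one, ENNReal.rpow_one, ENNReal.toReal_mul,
      toReal_enorm, toReal_enorm] at h1
    exact h1
  let T : V →ₗᵢ[ℝ] Lp ℝ p Q :=
    { toFun := fun v => c⁻¹ • Z v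
      map_add' := fun v w => by rw [hZadd, smul_add]
      map_smul' := fun a v => by rw [hZsmul, smul_comm]; rfl
      norm_map' := fun v => by
        change ‖c⁻¹ • Z v‖ = ‖v‖
        rw [norm_smul, hZnorm', norm_inv, Real.norm_of_nonneg hc0.le,
          inv_mul_cancel_left₀ hc0.ne'] }
  have : Nonempty Ω := nonempty_of_isProbabilityMeasure P
  -- As `ι` is countable, `Q` lives on a standard Borel space, so it is the law of a measurable
  -- function on `[0,1]`; composition with that function is isometric.
  obtain ⟨f, hf, hfQ⟩ := Measure.exists_measurable_map_eq Q
  exact ⟨(Lp.compMeasurePreservingₗᵢ ℝ f ⟨hf, hfQ⟩).comp T⟩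

end Embedding

/-! ### The embedding of `L_2`. -/

section Hilbert

/-- Distinct orthonormal vectors are at distance at least one, so balls of radius `1 / 2` around
them are disjoint open sets. -/
theorem Orthonormal.countable_of_secondCountable {E : Type*} [NormedAddCommGroup E]
    [InnerProductSpace ℝ E] [SecondCountableTopology E] {ι : Type*} {v : ι → E}
    (hv : Orthonormal ℝ v) : Countable ι := by
  have hdist : ∀ i j, i ≠ j → 1 ≤ dist (v i) (v j) := fun i j hij => by
    have h := norm_sub_sq_real (v i) (v j)
    rw [hv.2 hij, hv.1 i, hv.1 j] at h
    rw [dist_eq_norm]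
    nlinarith [norm_nonneg (v i - v j)]
  have hd : Pairwise (Function.onFun Disjoint fun i => Metric.ball (v i) (1 / 2)) :=
    fun i j hij => Metric.ball_disjoint_ball (by linarith [hdist i j hij])
  have := Set.PairwiseDisjoint.countable_of_isOpen (a := Set.univ)
    (fun i _ j _ hij => hd hij) (fun i _ => Metric.isOpen_ball)
    (fun i _ => ⟨v i, Metric.mem_ball_self (by norm_num)⟩)
  exact Set.countable_univ_iff.1 this

theorem HilbertBasis.tsum_enorm_inner_sq {E : Type*} [NormedAddCommGroup E]
    [InnerProductSpace ℝ E] {ι : Type*} (b : HilbertBasis ι ℝ E) (x : E) :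
    ∑' i, ‖inner ℝ (b i) x‖ₑ ^ 2 = ‖x‖ₑ ^ 2 := by
  have h := b.hasSum_inner_mul_inner x x
  have h1 : ∀ i, inner ℝ x (b i) * inner ℝ (b i) x = ‖inner ℝ (b i) x‖ ^ 2 := fun i => by
    rw [real_inner_comm, Real.norm_eq_abs, sq_abs, sq]
  simp only [h1, real_inner_self_eq_norm_sq] at h
  have h2 := ENNReal.ofReal_tsum_of_nonneg (fun i => by positivity) h.summable
  rw [h.tsum_eq] at h2
  simp only [ENNReal.ofReal_pow (norm_nonneg _), ofReal_norm] at h2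
  exact h2.symm

theorem exists_linearIsometry_LpUnit_two {p : ℝ≥0∞} [Fact (1 ≤ p)] (hp : p ≠ ∞) :
    Nonempty (LpUnit 2 →ₗᵢ[ℝ] LpUnit p) := by
  have : Fact ((2 : ℝ≥0∞) ≠ ∞) := ⟨by simp⟩
  have hsc : SecondCountableTopology (LpUnit 2) := Lp.SecondCountableTopology
  obtain ⟨w, b, -⟩ := exists_hilbertBasis ℝ (LpUnit 2)
  have hw : Countable w := b.orthonormal.countable_of_secondCountable
  -- A one-point space suffices: the coordinates are deterministic and all randomness comes from the
  -- Gaussians.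
  refine exists_linearIsometry_LpUnit (Ω := Unit) (P := Measure.dirac ()) hp
    (F := fun i v _ => inner ℝ (b i) v) (fun i v => measurable_const)
    (fun i v w => ae_of_all _ fun _ => inner_add_right _ _ _)
    (fun i c v => ae_of_all _ fun _ => inner_smul_right _ _ _) one_ne_zero ENNReal.one_ne_top
    fun v => ?_
  rw [lintegral_dirac, b.tsum_enorm_inner_sq, one_mul, ← ENNReal.rpow_natCast, ← ENNReal.rpow_mul]
  congr 1
  push_cast
  ring

end Hilbert

/-! ### Poisson point processes: Laplace functional and fractional moments. -/

section Poisson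

open ProbabilityTheory Filter Topology

variable {S : Type*} [MeasurableSpace S]

theorem lintegral_prod_range_infinitePi (μ : Measure S) [IsProbabilityMeasure μ] {g : S → ℝ≥0∞}
    (hg : Measurable g) (n : ℕ) :
    ∫⁻ x, ∏ j ∈ Finset.range n, g (x j) ∂Measure.infinitePi (fun _ : ℕ => μ) =
      (∫⁻ x, g x ∂μ) ^ n := by
  rw [lintegral_prod_eq_prod_lintegral_of_indepFun (Finset.range n)
    (fun j (x : ℕ → S) => g (x j)) (iIndepFun_infinitePi (X := fun _ => g) fun _ => hg)
    fun j => by fun_prop]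
  have h : ∀ j, ∫⁻ x, g (x j) ∂Measure.infinitePi (fun _ : ℕ => μ) = ∫⁻ x, g x ∂μ := fun j =>
    (measurePreserving_eval_infinitePi (fun _ : ℕ => μ) j).lintegral_comp hg
  simp [h]

/-- The law of a Poisson number, of mean one, of independent points with law `μ`; the points
beyond that number are carried along but not counted. -/
noncomputable def poissonBlock (μ : Measure S) [IsProbabilityMeasure μ] : Measure (ℕ × (ℕ → S)) :=
  (poissonMeasure 1).prod (Measure.infinitePi fun _ : ℕ => μ)

instance (μ : Measure S) [IsProbabilityMeasure μ] : IsProbabilityMeasure (poissonBlock μ) := by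
  unfold poissonBlock; infer_instance

theorem measurable_poissonBlock_prod {M : Type*} [CommMonoid M] [MeasurableSpace M]
    [MeasurableMul₂ M] {g : S → M} (hg : Measurable g) :
    Measurable fun z : ℕ × (ℕ → S) => ∏ j ∈ Finset.range z.1, g (z.2 j) :=
  measurable_from_prod_countable_right fun n => by dsimp only; fun_prop

theorem measurable_poissonBlock_sum {M : Type*} [AddCommMonoid M] [MeasurableSpace M]
    [MeasurableAdd₂ M] {g : S → M} (hg : Measurable g) :
    Measurable fun z : ℕ × (ℕ → S) => ∑ j ∈ Finset.range z.1, g (z.2 j) :=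
  measurable_from_prod_countable_right fun n => by dsimp only; fun_prop

theorem lintegral_one_sub_exp_add (μ : Measure S) [IsProbabilityMeasure μ] {h : S → ℝ}
    (hh : Measurable h) (h0 : ∀ x, 0 ≤ h x) :
    ∫⁻ x, ENNReal.ofReal (1 - Real.exp (-h x)) ∂μ + ∫⁻ x, ENNReal.ofReal (Real.exp (-h x)) ∂μ
      = 1 := by
  rw [← lintegral_add_left (by fun_prop)]
  have : ∀ x, ENNReal.ofReal (1 - Real.exp (-h x)) + ENNReal.ofReal (Real.exp (-h x)) = 1 :=
    fun x => by
      rw [← ENNReal.ofReal_add (sub_nonneg.2 (Real.exp_le_one_iff.2 (by linarith [h0 x])))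
        (Real.exp_pos _).le]
      simp
  simp [this]

/-- Given `n` points the expectation is `I ^ n`, where `I` is the integral of `exp (-h)`; averaging
over the Poisson number gives `exp (I - 1)`, and `1 - I` is the integral of `1 - exp (-h)`. -/
theorem lintegral_exp_poissonBlock (μ : Measure S) [IsProbabilityMeasure μ] {h : S → ℝ}
    (hh : Measurable h) (h0 : ∀ x, 0 ≤ h x) :
    ∫⁻ z, ENNReal.ofReal (Real.exp (-∑ j ∈ Finset.range z.1, h (z.2 j))) ∂poissonBlock μ =
      ENNReal.ofReal
        (Real.exp (-(∫⁻ x, ENNReal.ofReal (1 - Real.exp (-h x)) ∂μ).toReal)) := by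
  set I := ∫⁻ x, ENNReal.ofReal (Real.exp (-h x)) ∂μ with hI
  have hsum := lintegral_one_sub_exp_add μ hh h0
  set D := ∫⁻ x, ENNReal.ofReal (1 - Real.exp (-h x)) ∂μ with hD
  have hDt : D ≠ ∞ := ne_top_of_le_ne_top ENNReal.one_ne_top (hsum ▸ le_self_add)
  have hIt : I ≠ ∞ := ne_top_of_le_ne_top ENNReal.one_ne_top (hsum ▸ le_add_self)
  have hsum' : D.toReal + I.toReal = 1 := by
    rw [← ENNReal.toReal_add hDt hIt, hsum, ENNReal.toReal_one]
  have h1 : ∀ z : ℕ × (ℕ → S),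
      ENNReal.ofReal (Real.exp (-∑ j ∈ Finset.range z.1, h (z.2 j))) =
        ∏ j ∈ Finset.range z.1, ENNReal.ofReal (Real.exp (-h (z.2 j))) := fun z => by
    rw [← Finset.sum_neg_distrib, Real.exp_sum,
      ENNReal.ofReal_prod_of_nonneg fun _ _ => (Real.exp_pos _).le]
  have hg : Measurable fun x => ENNReal.ofReal (Real.exp (-h x)) := by fun_prop
  simp only [h1]
  rw [poissonBlock, lintegral_prod _ (measurable_poissonBlock_prod hg).aemeasurable]
  simp only [lintegral_prod_range_infinitePi μ hg, ← hI]
  rw [lintegral_countable']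
  simp only [poissonMeasure_singleton]
  have h2 : ∀ n : ℕ, I ^ n * ENNReal.ofReal (Real.exp (-((1 : NNReal) : ℝ)) *
        ((1 : NNReal) : ℝ) ^ n / (n.factorial : ℝ)) =
      ENNReal.ofReal (Real.exp (-1) * (I.toReal ^ n / n.factorial)) := fun n => by
    rw [← ENNReal.ofReal_toReal hIt, ← ENNReal.ofReal_pow ENNReal.toReal_nonneg,
      ← ENNReal.ofReal_mul (by positivity), ENNReal.toReal_ofReal ENNReal.toReal_nonneg]
    congr 1
    simp
    ring
  simp only [h2]
  have h3 : HasSum (fun n : ℕ => Real.exp (-1) * (I.toReal ^ n / n.factorial))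
      (Real.exp (-1) * Real.exp I.toReal) := by
    rw [Real.exp_eq_exp_ℝ]
    exact (NormedSpace.expSeries_div_hasSum_exp I.toReal).mul_left _
  rw [← ENNReal.ofReal_tsum_of_nonneg (fun n => by positivity) h3.summable, h3.tsum_eq,
    ← Real.exp_add]
  congr 2
  linarith

/-- The law of an independent sequence of Poisson blocks: a Poisson point process with intensity
`∑ μ k`. -/
noncomputable def poissonPointLaw (μ : ℕ → Measure S) [∀ k, IsProbabilityMeasure (μ k)] :
    Measure (ℕ → ℕ × (ℕ → S)) :=
  Measure.infinitePi fun k => poissonBlock (μ k)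

instance (μ : ℕ → Measure S) [∀ k, IsProbabilityMeasure (μ k)] :
    IsProbabilityMeasure (poissonPointLaw μ) := by
  unfold poissonPointLaw; infer_instance

/-- The sum of `h` over the points in the first `n` blocks. -/
noncomputable def poissonSum (h : S → ℝ) (n : ℕ) (ω : ℕ → ℕ × (ℕ → S)) : ℝ :=
  ∑ k ∈ Finset.range n, ∑ j ∈ Finset.range (ω k).1, h ((ω k).2 j)

theorem measurable_poissonSum {h : S → ℝ} (hh : Measurable h) (n : ℕ) :
    Measurable (poissonSum h n) := by
  unfold poissonSum
  refine Finset.measurable_sum _ fun k _ => ?_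
  exact (measurable_poissonBlock_sum hh).comp (measurable_pi_apply k)

theorem poissonSum_nonneg {T : Type*} {h : T → ℝ} (h0 : ∀ x, 0 ≤ h x) (n : ℕ)
    (ω : ℕ → ℕ × (ℕ → T)) :
    0 ≤ poissonSum h n ω :=
  Finset.sum_nonneg fun _ _ => Finset.sum_nonneg fun _ _ => h0 _

variable (μ : ℕ → Measure S) [∀ k, IsProbabilityMeasure (μ k)]

/-- The Laplace functional of a Poisson point process. -/
theorem lintegral_exp_poissonSum {h : S → ℝ} (hh : Measurable h) (h0 : ∀ x, 0 ≤ h x) (n : ℕ) :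
    ∫⁻ ω, ENNReal.ofReal (Real.exp (-poissonSum h n ω)) ∂poissonPointLaw μ =
      ENNReal.ofReal (Real.exp (-(∑ k ∈ Finset.range n,
        ∫⁻ x, ENNReal.ofReal (1 - Real.exp (-h x)) ∂μ k).toReal)) := by
  set φ : ℕ × (ℕ → S) → ℝ≥0∞ := fun z =>
    ENNReal.ofReal (Real.exp (-∑ j ∈ Finset.range z.1, h (z.2 j))) with hφ
  have hφm : Measurable φ := by
    have := measurable_poissonBlock_sum hh
    fun_prop
  have h1 : ∀ ω, ENNReal.ofReal (Real.exp (-poissonSum h n ω)) =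
      ∏ k ∈ Finset.range n, φ (ω k) := fun ω => by
    rw [poissonSum, ← Finset.sum_neg_distrib, Real.exp_sum,
      ENNReal.ofReal_prod_of_nonneg fun _ _ => (Real.exp_pos _).le]
  have hD : ∀ k, ∫⁻ x, ENNReal.ofReal (1 - Real.exp (-h x)) ∂μ k ≠ ∞ := fun k =>
    ne_top_of_le_ne_top ENNReal.one_ne_top (lintegral_one_sub_exp_add (μ k) hh h0 ▸ le_self_add)
  simp only [h1]
  rw [poissonPointLaw, lintegral_prod_eq_prod_lintegral_of_indepFun (Finset.range n)
    (fun k (ω : ℕ → ℕ × (ℕ → S)) => φ (ω k)) (iIndepFun_infinitePi (X := fun _ => φ) fun _ => hφm)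
    fun k => by fun_prop, ENNReal.toReal_sum fun k _ => hD k, ← Finset.sum_neg_distrib,
    Real.exp_sum, ENNReal.ofReal_prod_of_nonneg fun _ _ => (Real.exp_pos _).le]
  refine Finset.prod_congr rfl fun k _ => ?_
  rw [(measurePreserving_eval_infinitePi (fun k => poissonBlock (μ k)) k).lintegral_comp hφm]
  exact lintegral_exp_poissonBlock (μ k) hh h0

theorem lintegral_one_sub_exp_poissonSum {h : S → ℝ} (hh : Measurable h) (h0 : ∀ x, 0 ≤ h x)
    (n : ℕ) :
    ∫⁻ ω, ENNReal.ofReal (1 - Real.exp (-poissonSum h n ω)) ∂poissonPointLaw μ =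
      ENNReal.ofReal (1 - Real.exp (-(∑ k ∈ Finset.range n,
        ∫⁻ x, ENNReal.ofReal (1 - Real.exp (-h x)) ∂μ k).toReal)) := by
  have h1 := lintegral_one_sub_exp_add (poissonPointLaw μ) (measurable_poissonSum hh n)
    (poissonSum_nonneg h0 n)
  rw [lintegral_exp_poissonSum μ hh h0] at h1
  rw [ENNReal.ofReal_sub _ (Real.exp_pos _).le, ENNReal.ofReal_one, ← h1,
    ENNReal.add_sub_cancel_right ENNReal.ofReal_ne_top]

/-- Fractional moments of Poisson sums, from the Laplace functional. -/
theorem lintegral_poissonSum_rpow {h : S → ℝ} (hh : Measurable h) (h0 : ∀ x, 0 ≤ h x) {β : ℝ}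
    (hβ : 0 < β) (n : ℕ) :
    (∫⁻ ω, ENNReal.ofReal (poissonSum h n ω) ^ β ∂poissonPointLaw μ) * expPowerIntegral 1 β 1 =
      ∫⁻ t in Set.Ioi (0 : ℝ), ENNReal.ofReal ((1 - Real.exp (-(∑ k ∈ Finset.range n,
        ∫⁻ x, ENNReal.ofReal (1 - Real.exp (-(t * h x))) ∂μ k).toReal)) * t ^ (-1 - β)) := by
  have hm := measurable_poissonSum hh n
  rw [← lintegral_mul_const _ (by fun_prop)]
  -- The power of the sum is written as an integral over `t` of `1 - exp (-t · sum)`, so that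
  -- Tonelli leaves only the Laplace functional to compute.
  have h1 : ∀ ω, ENNReal.ofReal (poissonSum h n ω) ^ β * expPowerIntegral 1 β 1 =
      ∫⁻ t in Set.Ioi (0 : ℝ), ENNReal.ofReal
        ((1 - Real.exp (-(poissonSum h n ω * t ^ (1 : ℝ)))) * t ^ (-1 - β)) := fun ω => by
    rw [ENNReal.ofReal_rpow_of_nonneg (poissonSum_nonneg h0 n ω) hβ.le]
    have := expPowerIntegral_eq_of_nonneg (a := 1) (b := β) (by simpa using hβ)
      (poissonSum_nonneg h0 n ω)
    rw [div_one] at this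
    exact this.symm
  simp only [h1, Real.rpow_one]
  rw [lintegral_lintegral_swap (by fun_prop)]
  refine setLIntegral_congr_fun measurableSet_Ioi fun t ht => ?_
  have ht : 0 < t := ht
  have h2 : ∀ ω, poissonSum (fun x => t * h x) n ω = poissonSum h n ω * t := fun ω => by
    simp only [poissonSum, Finset.mul_sum, mul_comm _ t]
  have h3 := lintegral_one_sub_exp_poissonSum μ (h := fun x => t * h x) (by fun_prop)
    (fun x => mul_nonneg ht.le (h0 x)) n
  simp only [h2] at h3
  have h4 : ∀ x : ℝ, ENNReal.ofReal (x * t ^ (-1 - β)) =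
      ENNReal.ofReal x * ENNReal.ofReal (t ^ (-1 - β)) := fun x =>
    ENNReal.ofReal_mul' (by positivity)
  simp only [h4]
  rw [lintegral_mul_const _ (by fun_prop), h3]

/-- The fractional moments of the sum of `h` over a Poisson point process, when its Laplace
exponent is a power. -/
theorem lintegral_tsum_poisson_rpow {h : S → ℝ} (hh : Measurable h) (h0 : ∀ x, 0 ≤ h x)
    {α β D : ℝ} (hD : 0 ≤ D) (hβ : 0 < β) (hβ1 : β < 1) (hαβ : β < α)
    (hlap : ∀ t : ℝ, 0 < t →
      ∑' k, ∫⁻ x, ENNReal.ofReal (1 - Real.exp (-(t * h x))) ∂μ k = ENNReal.ofReal (D * t ^ α)) :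
    (∫⁻ ω, (∑' k, ∑ j ∈ Finset.range (ω k).1, ENNReal.ofReal (h ((ω k).2 j))) ^ β
        ∂poissonPointLaw μ) * expPowerIntegral 1 β 1 =
      ENNReal.ofReal (D ^ (β / α)) * expPowerIntegral α β 1 := by
  have hα : 0 < α := hβ.trans hαβ
  rw [← expPowerIntegral_eq_of_nonneg (div_pos hβ hα) hD]
  have hsum : ∀ n ω, ENNReal.ofReal (poissonSum h n ω) =
      ∑ k ∈ Finset.range n, ∑ j ∈ Finset.range (ω k).1, ENNReal.ofReal (h ((ω k).2 j)) :=
    fun n ω => by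
      rw [poissonSum, ENNReal.ofReal_sum_of_nonneg fun _ _ => Finset.sum_nonneg fun _ _ => h0 _]
      exact Finset.sum_congr rfl fun k _ => ENNReal.ofReal_sum_of_nonneg fun _ _ => h0 _
  have hm : ∀ n, Measurable fun ω => ENNReal.ofReal (poissonSum h n ω) ^ β := fun n => by
    have := measurable_poissonSum hh n
    fun_prop
  have hL : Tendsto (fun n => (∫⁻ ω, ENNReal.ofReal (poissonSum h n ω) ^ β ∂poissonPointLaw μ) *
      expPowerIntegral 1 β 1) atTop
      (𝓝 ((∫⁻ ω, (∑' k, ∑ j ∈ Finset.range (ω k).1, ENNReal.ofReal (h ((ω k).2 j))) ^ β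
        ∂poissonPointLaw μ) * expPowerIntegral 1 β 1)) := by
    refine ENNReal.Tendsto.mul_const ?_ (Or.inr ?_)
    · refine lintegral_tendsto_of_tendsto_of_monotone (fun n => (hm n).aemeasurable)
        (ae_of_all _ fun ω m n hmn => ?_) (ae_of_all _ fun ω => ?_)
      · simp only [hsum]
        exact ENNReal.rpow_le_rpow (Finset.sum_le_sum_of_subset (by gcongr)) hβ.le
      · simp only [hsum]
        exact (ENNReal.continuous_rpow_const.tendsto _).comp (ENNReal.tendsto_nat_tsum _)
    · exact (expPowerIntegral_one_lt_top (Or.inl ⟨hβ, hβ1⟩)).ne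
  -- The other side converges too: the partial Laplace exponents increase to `D t ^ α`, and monotone
  -- convergence applies in `t`.
  refine tendsto_nhds_unique hL ?_
  simp only [lintegral_poissonSum_rpow μ hh h0 hβ]
  rw [expPowerIntegral]
  have hDt : ∀ (t : ℝ), 0 < t → ∀ n, ∑ k ∈ Finset.range n,
      ∫⁻ x, ENNReal.ofReal (1 - Real.exp (-(t * h x))) ∂μ k ≤ ENNReal.ofReal (D * t ^ α) :=
    fun t ht n => hlap t ht ▸ ENNReal.sum_le_tsum _
  refine lintegral_tendsto_of_tendsto_of_monotone (fun n => ?_)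
    ((ae_restrict_mem measurableSet_Ioi).mono fun t ht m n hmn => ?_)
    ((ae_restrict_mem measurableSet_Ioi).mono fun t ht => ?_)
  · have : ∀ k, Measurable fun t : ℝ => ∫⁻ x, ENNReal.ofReal (1 - Real.exp (-(t * h x))) ∂μ k :=
      fun k => Measurable.lintegral_prod_right' (f := fun z : ℝ × S =>
        ENNReal.ofReal (1 - Real.exp (-(z.1 * h z.2)))) (by fun_prop)
    fun_prop
  · have ht : 0 < t := ht
    refine ENNReal.ofReal_le_ofReal (mul_le_mul_of_nonneg_right ?_ (by positivity))
    gcongr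
    exact ne_top_of_le_ne_top ENNReal.ofReal_ne_top (hDt t ht n)
  · have ht : 0 < t := ht
    have h5 := ENNReal.tendsto_nat_tsum
      fun k => ∫⁻ x, ENNReal.ofReal (1 - Real.exp (-(t * h x))) ∂μ k
    rw [hlap t ht] at h5
    have h6 := (ENNReal.tendsto_toReal ENNReal.ofReal_ne_top).comp h5
    rw [ENNReal.toReal_ofReal (by positivity)] at h6
    exact ENNReal.tendsto_ofReal (((h6.neg.rexp).const_sub 1).mul_const _)

end Poisson

/-! ### Stable variables and the embedding of `L_q` for `q < 2`. -/

section Stable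

open ProbabilityTheory

/-- Lebesgue measure on `(k, k + 1] × [0, 1]`. -/
noncomputable def stripMeasure (k : ℕ) : Measure (ℝ × unitInterval) :=
  (volume.restrict (Set.Ioc (k : ℝ) (k + 1))).prod volume

instance (k : ℕ) : IsProbabilityMeasure (volume.restrict (Set.Ioc (k : ℝ) (k + 1))) :=
  ⟨by simp⟩

instance (k : ℕ) : IsProbabilityMeasure (stripMeasure k) := by
  unfold stripMeasure; infer_instance

theorem iUnion_Ioc_natCast : ⋃ k : ℕ, Set.Ioc (k : ℝ) (k + 1) = Set.Ioi 0 := by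
  ext x
  simp only [Set.mem_iUnion, Set.mem_Ioc, Set.mem_Ioi]
  refine ⟨fun ⟨k, hk, _⟩ => k.cast_nonneg.trans_lt hk, fun hx => ⟨⌈x⌉₊ - 1, ?_⟩⟩
  have h1 : 1 ≤ ⌈x⌉₊ := Nat.one_le_ceil_iff.2 hx
  rw [Nat.cast_sub h1, Nat.cast_one, sub_add_cancel]
  exact ⟨by linarith [Nat.ceil_lt_add_one hx.le], Nat.le_ceil x⟩

/-- The unit strips tile `(0, ∞) × [0, 1]`; cutting the infinite intensity into probability measures
is what lets the process be built from independent blocks. -/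
theorem tsum_lintegral_stripMeasure {g : ℝ × unitInterval → ℝ≥0∞} (hg : Measurable g) :
    ∑' k, ∫⁻ z, g z ∂stripMeasure k = ∫⁻ u : unitInterval, ∫⁻ s in Set.Ioi (0 : ℝ), g (s, u) := by
  have h1 : ∀ k, ∫⁻ z, g z ∂stripMeasure k =
      ∫⁻ u : unitInterval, ∫⁻ s in Set.Ioc (k : ℝ) (k + 1), g (s, u) := fun k =>
    lintegral_prod_symm' _ hg
  simp only [h1]
  rw [← lintegral_tsum fun k => (hg.lintegral_prod_left').aemeasurable]
  refine lintegral_congr fun u => ?_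
  rw [← iUnion_Ioc_natCast, lintegral_iUnion (fun k => measurableSet_Ioc)]
  intro i j hij
  refine Set.disjoint_left.2 fun x hx hy => hij ?_
  have h2 : (i : ℝ) < j + 1 := hx.1.trans_le hy.2
  have h3 : (j : ℝ) < i + 1 := hy.1.trans_le hx.2
  norm_cast at h2 h3
  omega

/-- The coordinates of the embedding: a point `(s, u)` of the process contributes
`s ^ (-1 / q) f(u)`. -/
noncomputable def stableCoordinate (q : ℝ) (i : ℕ × ℕ) (f : unitInterval → ℝ)
    (ω : ℕ → ℕ × (ℕ → ℝ × unitInterval)) : ℝ :=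
  if i.2 < (ω i.1).1 then ((ω i.1).2 i.2).1 ^ (-1 / q) * f ((ω i.1).2 i.2).2 else 0

theorem measurable_stableCoordinate (q : ℝ) (i : ℕ × ℕ) {f : unitInterval → ℝ}
    (hf : Measurable f) : Measurable (stableCoordinate q i f) := by
  unfold stableCoordinate
  refine Measurable.ite ?_ (by fun_prop) measurable_const
  exact measurableSet_lt measurable_const (by fun_prop)

/-- The mark of each point is uniform on `[0,1]`, so almost everywhere identities between
representatives in `L_q` pass to the coordinates. -/
theorem measurePreserving_point (k j : ℕ) :
    MeasurePreserving (fun ω : ℕ → ℕ × (ℕ → ℝ × unitInterval) => ((ω k).2 j).2)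
      (poissonPointLaw stripMeasure) volume := by
  have h1 := measurePreserving_eval_infinitePi (fun k => poissonBlock (stripMeasure k)) k
  have h2 : MeasurePreserving Prod.snd (poissonBlock (stripMeasure k))
      (Measure.infinitePi fun _ : ℕ => stripMeasure k) := measurePreserving_snd
  have h3 := measurePreserving_eval_infinitePi (fun _ : ℕ => stripMeasure k) j
  have h4 : MeasurePreserving Prod.snd (stripMeasure k) volume := measurePreserving_snd
  exact ((h4.comp h3).comp h2).comp h1

theorem tsum_enorm_stableCoordinate_sq (q : ℝ) (f : unitInterval → ℝ)
    (ω : ℕ → ℕ × (ℕ → ℝ × unitInterval)) :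
    ∑' i, ‖stableCoordinate q i f ω‖ₑ ^ 2 = ∑' k, ∑ j ∈ Finset.range (ω k).1,
      ENNReal.ofReal ((((ω k).2 j).1 ^ (-1 / q) * f ((ω k).2 j).2) ^ 2) := by
  rw [ENNReal.tsum_prod']
  refine tsum_congr fun k => ?_
  rw [tsum_eq_sum (s := Finset.range (ω k).1)]
  · refine Finset.sum_congr rfl fun j hj => ?_
    rw [stableCoordinate, if_pos (Finset.mem_range.1 hj), ← sq_abs,
      ENNReal.ofReal_pow (abs_nonneg _), ← Real.norm_eq_abs, ofReal_norm]
  · intro j hj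
    rw [stableCoordinate, if_neg (by simpa using hj)]
    simp

/-- The Laplace exponent of the positive `q / 2`-stable random measure. -/
theorem tsum_lintegral_stable {q : ℝ} (hq : 0 < q) {f : unitInterval → ℝ}
    (hf : Measurable f) {t : ℝ} (ht : 0 < t) :
    ∑' k, ∫⁻ x, ENNReal.ofReal (1 - Real.exp (-(t * (x.1 ^ (-1 / q) * f x.2) ^ 2)))
        ∂stripMeasure k =
      ENNReal.ofReal (t ^ (q / 2)) * expPowerIntegral (-2 / q) (-1) 1 *
        ∫⁻ u, ‖f u‖ₑ ^ q := by
  rw [tsum_lintegral_stripMeasure (by fun_prop), mul_assoc, ← lintegral_const_mul _ (by fun_prop),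
    ← lintegral_const_mul _ (by fun_prop)]
  refine lintegral_congr fun u => ?_
  have h1 : ∫⁻ s in Set.Ioi (0 : ℝ), ENNReal.ofReal
      (1 - Real.exp (-(t * (s ^ (-1 / q) * f u) ^ 2))) =
      -- The choice `b = -1` turns the weight `s ^ (-1 - b)` into `1`, so this is plain Lebesgue
      -- measure in `s`.
      expPowerIntegral (-2 / q) (-1) (t * f u ^ 2) := by
    refine setLIntegral_congr_fun measurableSet_Ioi fun s hs => ?_
    have hs : 0 < s := hs
    have h2 : (s ^ (-1 / q)) ^ 2 = s ^ (-2 / q) := by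
      rw [← Real.rpow_natCast, ← Real.rpow_mul hs.le]
      congr 1
      push_cast
      ring
    have h3 : (-1 : ℝ) - -1 = 0 := by norm_num
    rw [mul_pow, h2, h3, Real.rpow_zero, mul_one]
    congr 4
    ring
  have h4 : (-1 : ℝ) / (-2 / q) = q / 2 := by field_simp
  rw [h1, expPowerIntegral_eq_of_nonneg (by rw [h4]; positivity) (by positivity), h4,
    Real.mul_rpow ht.le (sq_nonneg _), ENNReal.ofReal_mul (by positivity), mul_assoc,
    mul_comm (ENNReal.ofReal ((f u ^ 2) ^ (q / 2)))]
  congr 2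
  rw [enorm_rpow_eq_ofReal _ hq.le, Real.norm_eq_abs, ← sq_abs, ← Real.rpow_natCast,
    ← Real.rpow_mul (abs_nonneg _)]
  congr 2
  push_cast
  ring

/-- For `p < q < 2`, the space `L_q[0,1]` embeds linearly isometrically into `L_p[0,1]`. -/
theorem exists_linearIsometry_LpUnit_of_lt_two {p q : ℝ≥0∞} [Fact (1 ≤ p)] [Fact (1 ≤ q)]
    (hpq : p < q) (hq2 : q < 2) : Nonempty (LpUnit q →ₗᵢ[ℝ] LpUnit p) := by
  have hp : p ≠ ∞ := (hpq.trans_le le_top).ne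
  have hqt : q ≠ ∞ := (hq2.trans (by simp)).ne
  have hp0 : p ≠ 0 := (zero_lt_one.trans_le Fact.out).ne'
  have hq0 : q ≠ 0 := (zero_lt_one.trans_le Fact.out).ne'
  have hpr : 0 < p.toReal := ENNReal.toReal_pos hp0 hp
  have hqr : 0 < q.toReal := ENNReal.toReal_pos hq0 hqt
  have hlt : p.toReal < q.toReal := (ENNReal.toReal_lt_toReal hp hqt).2 hpq
  have hlt2 : q.toReal < 2 := by
    simpa using (ENNReal.toReal_lt_toReal hqt (by simp)).2 hq2
  set r := p.toReal
  set s := q.toReal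
  set C := expPowerIntegral (-2 / s) (-1) 1
  -- Finiteness here needs `-2 / q < -1`, that is `q < 2`; this is why `q = 2` is treated
  -- separately.
  have hCt : C ≠ ∞ := (expPowerIntegral_one_lt_top (Or.inr ⟨by
    rw [div_lt_iff₀ hqr]; linarith, by norm_num⟩)).ne
  have hC0 : C ≠ 0 := expPowerIntegral_one_pos _ _
  set A := expPowerIntegral 1 (r / 2) 1
  have hAt : A ≠ ∞ :=
    (expPowerIntegral_one_lt_top (Or.inl ⟨by positivity, by linarith⟩)).ne
  have hA0 : A ≠ 0 := expPowerIntegral_one_pos _ _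
  set B := expPowerIntegral (s / 2) (r / 2) 1
  -- A `q / 2`-stable variable has a finite moment of order `p / 2` because `p < q`.
  have hBt : B ≠ ∞ :=
    (expPowerIntegral_one_lt_top (Or.inl ⟨by positivity, by linarith⟩)).ne
  have hB0 : B ≠ 0 := expPowerIntegral_one_pos _ _
  have hsb : StandardBorelSpace unitInterval := inferInstance
  have hsb3 : StandardBorelSpace (ℕ × (ℕ → ℝ × unitInterval)) := inferInstance
  refine exists_linearIsometry_LpUnit (P := poissonPointLaw stripMeasure) hp
    (F := fun i (f : LpUnit q) => stableCoordinate s i f)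
    (fun i f => measurable_stableCoordinate s i (Lp.stronglyMeasurable f).measurable)
    (fun i f g => ?_) (fun i c f => ?_) (K := C ^ (r / s) * B / A) ?_ ?_ fun f => ?_
  · filter_upwards [(measurePreserving_point i.1 i.2).quasiMeasurePreserving.ae
      (Lp.coeFn_add f g)] with ω hω
    simp only [stableCoordinate, Pi.add_apply, hω]
    split_ifs <;> ring
  · filter_upwards [(measurePreserving_point i.1 i.2).quasiMeasurePreserving.ae
      (Lp.coeFn_smul c f)] with ω hω
    simp only [stableCoordinate, Pi.smul_apply, hω, smul_eq_mul]
    split_ifs <;> ring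
  · exact ENNReal.div_ne_zero.2
      ⟨mul_ne_zero (by simp [ENNReal.rpow_eq_zero_iff, hC0, hCt]) hB0, hAt⟩
  · exact ENNReal.div_ne_top
      (ENNReal.mul_ne_top (ENNReal.rpow_ne_top_of_nonneg (by positivity) hCt) hBt) hA0
  · have hfm : Measurable f := (Lp.stronglyMeasurable f).measurable
    have hft : ‖f‖ₑ ^ s ≠ ∞ := ENNReal.rpow_ne_top_of_nonneg hqr.le enorm_ne_top
    have hD : C * ‖f‖ₑ ^ s ≠ ∞ := ENNReal.mul_ne_top hCt hft
    have h := lintegral_tsum_poisson_rpow stripMeasure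
      (h := fun x : ℝ × unitInterval => (x.1 ^ (-1 / s) * f x.2) ^ 2) (by fun_prop)
      (fun x => sq_nonneg _) (α := s / 2) (β := r / 2) (D := (C * ‖f‖ₑ ^ s).toReal)
      ENNReal.toReal_nonneg (by positivity) (by linarith) (by linarith) fun t ht => by
        rw [tsum_lintegral_stable hqr hfm ht, ENNReal.ofReal_mul ENNReal.toReal_nonneg,
          ENNReal.ofReal_toReal hD, Lp_enorm_rpow hq0 hqt]
        ring
    simp only [tsum_enorm_stableCoordinate_sq]
    have hexp : r / 2 / (s / 2) = r / s := by field_simp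
    rw [hexp, ← ENNReal.ofReal_rpow_of_nonneg ENNReal.toReal_nonneg (by positivity),
      ENNReal.ofReal_toReal hD, ENNReal.mul_rpow_of_nonneg _ _ (by positivity),
      ← ENNReal.rpow_mul, mul_div_cancel₀ _ hqr.ne'] at h
    rw [(ENNReal.eq_div_iff hA0 hAt).2 ((mul_comm _ _).trans h), ENNReal.div_eq_inv_mul,
      ENNReal.div_eq_inv_mul]
    ring

end Stable

/-! ### Conclusion. -/

theorem isIsomorphicWith_of_linearIsometryEquiv {E F : Type*} [NormedAddCommGroup E]
    [NormedSpace ℝ E] [NormedAddCommGroup F] [NormedSpace ℝ F] (e : E ≃ₗᵢ[ℝ] F) {C : ℝ}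
    (hC : 1 ≤ C) : IsIsomorphicWith C E F := by
  refine ⟨e.toContinuousLinearEquiv, ?_⟩
  have h1 : ‖(e.toContinuousLinearEquiv : E →L[ℝ] F)‖ ≤ 1 :=
    ContinuousLinearMap.opNorm_le_bound _ zero_le_one fun x => by
      rw [one_mul]; exact (e.norm_map x).le
  have h2 : ‖(e.toContinuousLinearEquiv.symm : F →L[ℝ] E)‖ ≤ 1 :=
    ContinuousLinearMap.opNorm_le_bound _ zero_le_one fun x => by
      rw [one_mul]; exact (e.symm.norm_map x).le
  calc _ ≤ (1 : ℝ) * 1 := mul_le_mul h1 h2 (norm_nonneg _) zero_le_one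
    _ ≤ C := by linarith

theorem proposition4p1 (p q : ℝ≥0∞) [Fact (1 ≤ p)] [Fact (1 ≤ q)]
    (hpq : (1 ≤ p ∧ p < q ∧ q ≤ 2) ∨ (q = 2 ∧ 2 < p ∧ p < ∞)) :
    (∃ ε : ℝ, 0 < ε ∧
      ∀ (E : Submodule ℝ (LpUnit p)) (F : Submodule ℝ (LpUnit q)),
        IsIsomorphicWith (1 + ε) E F → DoesSPR E) ∧
    (∃ E : Submodule ℝ (LpUnit p), Nonempty (LpUnit q ≃ₗᵢ[ℝ] E) ∧ DoesSPR E) := by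
  have ha : ∃ ε : ℝ, 0 < ε ∧
      ∀ (E : Submodule ℝ (LpUnit p)) (F : Submodule ℝ (LpUnit q)),
        IsIsomorphicWith (1 + ε) E F → DoesSPR E := by
    rcases hpq with ⟨-, h1, h2⟩ | ⟨rfl, h1, h2⟩
    · exact doesSPR_of_isIsomorphicWith_of_lt_of_le_two h1 h2
    · exact doesSPR_of_isIsomorphicWith_two h1 h2.ne
  have hT : Nonempty (LpUnit q →ₗᵢ[ℝ] LpUnit p) := by
    rcases hpq with ⟨-, h1, h2⟩ | ⟨rfl, h1, h2⟩
    · rcases h2.eq_or_lt with rfl | h2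
      · exact exists_linearIsometry_LpUnit_two (h1.trans (by simp)).ne
      · exact exists_linearIsometry_LpUnit_of_lt_two h1 h2
    · exact exists_linearIsometry_LpUnit_two h2.ne
  refine ⟨ha, ?_⟩
  obtain ⟨ε, hε, hSPR⟩ := ha
  obtain ⟨T⟩ := hT
  -- The range of the isometry is isometric to the whole of `L_q`, the subspace `⊤`, so part (a)
  -- applies to it.
  refine ⟨LinearMap.range T.toLinearMap, ⟨T.equivRange⟩, hSPR _ ⊤ ?_⟩
  exact isIsomorphicWith_of_linearIsometryEquiv
    (T.equivRange.symm.trans (LinearIsometryEquiv.ofTop (LpUnit q) ⊤ rfl).symm) (by linarith)
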